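/- **Setting.** Let $L\ge 2$ and let a domain in $\mathbb R^d$ be bisected recursively along a perfect binary tree with $L$ levels (root at level $1$, leaves at level $L$): every node $i$ carries a subdomain $\Omega_i$, and the subdomains of the two children $c_1,c_2$ of a non-leaf node partition its subdomain. Let $x_1,\dots,x_n$ and $y_1,\dots,y_n$ be points of the root domain, let $\kappa$ be a real or complex kernel, and put $A=[\kappa(x_a,y_b)]_{a,b=1}^n$. For a node $i$, $\mathbf i^{row}$ and $\mathbf i^{col}$ are the sets of the indices of the points $x_a$, respectively $y_b$, in $\Omega_i$. The center $a$ and the radius $\delta$ of a set $S$ are the minimizer and the minimum of $c\mapsto\sup_{z\in S}|z-c|$. Fix $\tau\in(0,1)$. Two sets with centers $a,b$ and radii $\delta_a,\delta_b>0$ are well-separated if $\delta_a+\delta_b\le\tau|a-b|$. We write $(i,j)\in\mathrm{Sep}$ if $\Omega_i,\Omega_j$ are well-separated, and $\mathcal N_i=\{j\ne i:\ j\text{ at the level of }i,\ (i,j)\notin\mathrm{Sep}\}$. **HSS construction by SMASH**, with SRRQR (strong rank-revealing QR) bound $s>1$ and tolerances $\epsilon_{SVD},\epsilon_{far}\ge0$.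 For the levels $l=L,L-1,\dots,2$ and each node $i$ at level $l$, put $\bar{\mathbf i}^{row}=\mathbf i^{row}$, $\bar{\mathbf i}^{col}=\mathbf i^{col}$ if $i$ is a leaf, and $\bar{\mathbf i}^{row}=\hat{\mathbf c}_1^{row}\cup\hat{\mathbf c}_2^{row}$, $\bar{\mathbf i}^{col}=\hat{\mathbf c}_1^{col}\cup\hat{\mathbf c}_2^{col}$ otherwise. * *Nearfield.* Singular triples are computed for the matrices $A_i^-=[A|_{\bar{\mathbf i}^{row}\times\bar{\mathbf j}^{col}}]_{j\in\mathcal N_i}=S_i\Sigma_i\widetilde S+E_i^-$ and $A_i^|=[(A|_{\bar{\mathbf j}^{row}\times\bar{\mathbf i}^{col}})^T]_{j\in\mathcal N_i}=T_i\Sigma_i'\widetilde T+E_i^|$ (truncated SVDs), where for every $j\in\mathcal N_i$ the $j$-th blocks of $E_i^-$ and $E_i^|$ have Frobenius norm at most $\sqrt{|\bar{\mathbf i}^{row}||\bar{\mathbf j}^{col}|}\,\epsilon_{SVD}\|A_i^-\|_2$ and $\sqrt{|\bar{\mathbf i}^{col}||\bar{\mathbf j}^{row}|}\,\epsilon_{SVD}\|A_i^|\|_2$,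 respectively. * *Farfield.* Matrices $\hat U_i$ and $\hat V_i$, with rows indexed by $\bar{\mathbf i}^{row}$ and $\bar{\mathbf i}^{col}$, are given such that for all $(i,j)\in\mathrm{Sep}$ at the same level there is a matrix $\hat B_{i,j}$ with $\|A|_{\bar{\mathbf i}^{row}\times\bar{\mathbf j}^{col}}-\hat U_i\hat B_{i,j}\hat V_j^T\|_{\max}\le\epsilon_{far}\|A|_{\bar{\mathbf i}^{row}\times\bar{\mathbf j}^{col}}\|_{\max}$. * *Compression.* SRRQR of $C^T$ for $C=[\hat U_i,S_i]$, that is, $C^TP_i=Q\begin{bmatrix}R_{11}&R_{12}\\0&0\end{bmatrix}$ with a permutation $P_i$, $Q$ unitary, $R_{11}$ upper triangular and invertible and $\|R_{11}^{-1}R_{12}\|_{\max}\le s$, selects $\hat{\mathbf i}^{row}\subseteq\bar{\mathbf i}^{row}$ (the rows of $C$ that $P_i$ puts first) and gives $P_i\begin{bmatrix}I\\G_i\end{bmatrix}$, $G_i=(R_{11}^{-1}R_{12})^T$. In the same way $[\hat V_i,T_i]$ yields $\hat{\mathbf i}^{col}$ and $F_i\begin{bmatrix}I\\H_i\end{bmatrix}$.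 Let $U^{(l)}$ and $V^{(l)}$ be the block diagonal matrices with the blocks $P_i\begin{bmatrix}I\\G_i\end{bmatrix}$ and $F_i\begin{bmatrix}I\\H_i\end{bmatrix}$, $i$ at level $l$. Let $B^{(L)}=\mathrm{diag}(A|_{\mathbf i^{row}\times\mathbf i^{col}})_{i\text{ leaf}}$, and for $l<L$ let $B^{(l)}=\mathrm{diag}\begin{bmatrix}0&A|_{\hat{\mathbf c}_1^{row}\times\hat{\mathbf c}_2^{col}}\\A|_{\hat{\mathbf c}_2^{row}\times\hat{\mathbf c}_1^{col}}&0\end{bmatrix}$ over the nodes at level $l$, with children $c_1,c_2$. **Rank assumptions.** There are positive integers $r^{(l)}$, $2\le l\le L$, with $|\hat{\mathbf i}^{row}|,|\hat{\mathbf i}^{col}|\le r^{(l)}$ for all $i$ at level $l$ and $r^{(l+1)}\le r^{(l)}$ for $2\le l<L$. Put $r^{(L+1)}:=r^{(L)}$; for every leaf $i$, $|\mathbf i^{row}|,|\mathbf i^{col}|\le 2r^{(L)}$. **Theorem 4.5.** Under these assumptions $$A=U^{(L)}\Big(U^{(L-1)}\big(\cdots\big(U^{(2)}B^{(1)}(V^{(2)})^T+B^{(2)}\big)\cdots\big)(V^{(L-1)})^T+B^{(L-1)}\Big)(V^{(L)})^T+B^{(L)}+E,$$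 $$\|E\|_F\le C_1\,\epsilon_{SVD}\|A\|_F+C_2\,\epsilon_{far}\|A\|_F,$$ $$C_1=\sum_{l=2}^{\max(2,L-1)}2^{L+l/2+2}s^{2L-2l+2}\big(r^{(l+1)}\cdots r^{(L)}\big)^2\big(r^{(l+1)}\big)^{3/2}\big(r^{(l)}\big)^{5/2},\qquad C_2=\sum_{l=2}^{L}2^{L+2}s^{2L-2l+2}\big(r^{(l)}r^{(l+1)}\cdots r^{(L)}\big)^2r^{(l+1)}.$$ -/

import Mathlib

namespace SMASH

/-! ### Norms of finite matrices -/

section Norms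

variable {𝕜 : Type*} [RCLike 𝕜] {m c : Type*} [Fintype m] [Fintype c]

open scoped Matrix.Norms.Frobenius in
/-- The Frobenius norm. -/
noncomputable def frobNorm (M : Matrix m c 𝕜) : ℝ := ‖M‖

open scoped Matrix.Norms.L2Operator in
/-- The spectral norm (operator norm for the Euclidean norms). -/
noncomputable def specNorm [DecidableEq c] (M : Matrix m c 𝕜) : ℝ := ‖M‖

/-- The largest absolute value of an entry (`0` for a matrix without entries). -/
noncomputable def maxNorm (M : Matrix m c 𝕜) : ℝ :=
  ((Finset.univ.sup fun p : m × c => ‖M p.1 p.2‖₊ : NNReal) : ℝ)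

end Norms

/-! ### Well-separated sets -/

/-- `c` is the centre and `δ` the radius of the nonempty set `S`:
`δ = min_c sup_{z ∈ S} |z - c|`, and the minimum is attained at `c`. -/
def IsCenterRadius {d : ℕ} (S : Set (EuclideanSpace ℝ (Fin d)))
    (c : EuclideanSpace ℝ (Fin d)) (δ : ℝ) : Prop :=
  S.Nonempty ∧ S ⊆ Metric.closedBall c δ ∧
    ∀ (c' : EuclideanSpace ℝ (Fin d)) (δ' : ℝ), S ⊆ Metric.closedBall c' δ' → δ ≤ δ'

/-- `S` and `T` are well-separated with separation ratio `τ`. -/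
def WellSeparated {d : ℕ} (τ : ℝ) (S T : Set (EuclideanSpace ℝ (Fin d))) : Prop :=
  ∃ (a b : EuclideanSpace ℝ (Fin d)) (δa δb : ℝ), 0 < δa ∧ 0 < δb ∧
    IsCenterRadius S a δa ∧ IsCenterRadius T b δb ∧ δa + δb ≤ τ * dist a b

/-! ### Perfect binary trees and partitions of the domain -/

/-- Nodes of the perfect binary tree at depth `k`, that is, at level `l = k + 1`
(the root has level `1`). A node of depth `k + 1` is a parent together with a side. -/
def Node : ℕ → Type
  | 0 => Unit
  | k + 1 => Node k × Bool

/-- The child of `i` on side `b`. -/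
def Node.child {k : ℕ} (i : Node k) (b : Bool) : Node (k + 1) := (i, b)

instance Node.instDecidableEq : (k : ℕ) → DecidableEq (Node k)
  | 0 => inferInstanceAs (DecidableEq Unit)
  | k + 1 =>
    haveI := Node.instDecidableEq k
    inferInstanceAs (DecidableEq (Node k × Bool))

instance Node.instFintype : (k : ℕ) → Fintype (Node k)
  | 0 => inferInstanceAs (Fintype Unit)
  | k + 1 =>
    haveI := Node.instFintype k
    inferInstanceAs (Fintype (Node k × Bool))

/-- A recursive bisection, with `L` levels, of a domain in `ℝ^d`: every node carries a subdomain,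
and the subdomains of its two children partition it. -/
structure Partition (d L : ℕ) where
  dom : (k : ℕ) → Node k → Set (EuclideanSpace ℝ (Fin d))
  union_children : ∀ k, k + 1 < L → ∀ i : Node k,
    dom (k + 1) (i.child false) ∪ dom (k + 1) (i.child true) = dom k i
  disjoint_children : ∀ k, k + 1 < L → ∀ i : Node k,
    Disjoint (dom (k + 1) (i.child false)) (dom (k + 1) (i.child true))

section Construction

variable {𝕜 : Type*} [RCLike 𝕜] {d n L : ℕ}

/-- Indices of the points that lie in `S`. -/
noncomputable def indicesIn (x : Fin n → EuclideanSpace ℝ (Fin d))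
    (S : Set (EuclideanSpace ℝ (Fin d))) : Finset (Fin n) := by
  classical exact Finset.univ.filter fun a => x a ∈ S

/-- The intermediate index set `ī` of a node: all of its points at a leaf, and the union of the
index sets selected at its two children otherwise. -/
noncomputable def bar (T : Partition d L) (x : Fin n → EuclideanSpace ℝ (Fin d))
    (hat : (k : ℕ) → Node k → Finset (Fin n)) (k : ℕ) (i : Node k) : Finset (Fin n) :=
  if k + 1 < L then hat (k + 1) (i.child false) ∪ hat (k + 1) (i.child true)
  else indicesIn x (T.dom k i)

/-- The nearfield nodes of `i`: the other nodes of the same level whose subdomain is not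
well-separated from that of `i`. -/
def nearfield (T : Partition d L) (τ : ℝ) (k : ℕ) (i : Node k) : Set (Node k) :=
  {j | j ≠ i ∧ ¬ WellSeparated τ (T.dom k i) (T.dom k j)}

noncomputable instance nearfield.instFintype (T : Partition d L) (τ : ℝ) (k : ℕ) (i : Node k) :
    Fintype (nearfield T τ k i) := Fintype.ofFinite _

/-- The kernel matrix `[κ(x, y)]`. -/
def kernelMatrix (κ : EuclideanSpace ℝ (Fin d) → EuclideanSpace ℝ (Fin d) → 𝕜)
    (x y : Fin n → EuclideanSpace ℝ (Fin d)) : Matrix (Fin n) (Fin n) 𝕜 :=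
  Matrix.of fun a b => κ (x a) (y b)

/-- The submatrix `A|_{I × J}`. -/
def block (A : Matrix (Fin n) (Fin n) 𝕜) (I J : Finset (Fin n)) : Matrix I J 𝕜 :=
  A.submatrix Subtype.val Subtype.val

/-- The block row `[A|_{I × J_j}]_{j ∈ N}`. -/
def nearRow {ν : Type*} (A : Matrix (Fin n) (Fin n) 𝕜) (I : Finset (Fin n))
    (N : Set ν) (J : ν → Finset (Fin n)) : Matrix I (Σ j : N, J j.1) 𝕜 :=
  Matrix.of fun a p => A a.1 p.2.1

/-- Truncated singular value decomposition `M = S Σ Z + error`: the columns of `S`, the (conjugated)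
rows of `Z` and the entries of `Σ` are `rank` orthonormal pairs of left and right singular vectors
of `M` with their singular values. -/
structure TruncatedSVD {m c : Type*} [Fintype m] [Fintype c] (M : Matrix m c 𝕜) where
  rank : ℕ
  S : Matrix m (Fin rank) 𝕜
  sing : Fin rank → ℝ
  Z : Matrix (Fin rank) c 𝕜
  sing_pos : ∀ t, 0 < sing t
  left_orthonormal : S.conjTranspose * S = 1
  right_orthonormal : Z * Z.conjTranspose = 1
  mul_right : M * Z.conjTranspose = S * Matrix.diagonal fun t => (sing t : 𝕜)
  left_mul : S.conjTranspose * M = (Matrix.diagonal fun t => (sing t : 𝕜)) * Z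

/-- The truncation error `M - S Σ Z`. -/
def TruncatedSVD.error {m c : Type*} [Fintype m] [Fintype c] {M : Matrix m c 𝕜}
    (D : TruncatedSVD M) : Matrix m c 𝕜 :=
  M - D.S * (Matrix.diagonal fun t => (D.sing t : 𝕜)) * D.Z

/-- The truncated SVD of the nearfield block row has relative tolerance `ε` on each block. -/
def TruncatedSVD.HasTolerance {ν : Type*} {A : Matrix (Fin n) (Fin n) 𝕜}
    {I : Finset (Fin n)} {N : Set ν} [Fintype N] [DecidableEq ν] {J : ν → Finset (Fin n)}
    (D : TruncatedSVD (nearRow A I N J)) (ε : ℝ) : Prop :=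
  ∀ j : N, frobNorm (D.error.submatrix id fun b : J j.1 => (⟨j, b⟩ : Σ j : N, J j.1)) ≤
    √((I.card : ℝ) * (J j.1).card) * ε * specNorm (nearRow A I N J)

/-- A strong rank-revealing QR factorization `M P = Q [R₁₁ R₁₂; 0 0]` of a `p × q` matrix of rank
`k` with entrywise bound `s`. The permutation `P` of the columns is `e` (the first `k` columns are
the `e (inl t)`), and `f` only numbers the rows of the triangular factor. -/
structure IsSRRQR (s : ℝ) {p q : Type*} [Fintype p] [DecidableEq p] {k k₁ k₂ : ℕ}
    (M : Matrix p q 𝕜) (e : Fin k ⊕ Fin k₁ ≃ q) (f : Fin k ⊕ Fin k₂ ≃ p) (Q : Matrix p p 𝕜)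
    (R₁₁ : Matrix (Fin k) (Fin k) 𝕜) (R₁₂ : Matrix (Fin k) (Fin k₁) 𝕜) : Prop where
  unitary : Q ∈ Matrix.unitaryGroup p 𝕜
  upper : R₁₁.BlockTriangular id
  invertible : IsUnit R₁₁.det
  factorization :
    M.submatrix id e = Q * (Matrix.fromBlocks R₁₁ R₁₂ 0 0).submatrix f.symm id
  bound : ∀ a b, ‖(R₁₁⁻¹ * R₁₂) a b‖ ≤ s

/-- `[P, G, H] = compr(C, I)` with `U = P [1; G]`: SRRQR of `Cᵀ` selects the rows `H ⊆ I` of `C`,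
and `G = (R₁₁⁻¹ R₁₂)ᵀ`. -/
def IsCompr (s : ℝ) {I : Finset (Fin n)} {p : Type*} [Fintype p] [DecidableEq p]
    (C : Matrix I p 𝕜) (H : Finset (Fin n)) (U : Matrix I H 𝕜) : Prop :=
  ∃ (k k₁ k₂ : ℕ) (e : Fin k ⊕ Fin k₁ ≃ I) (f : Fin k ⊕ Fin k₂ ≃ p) (g : Fin k ≃ H)
    (Q : Matrix p p 𝕜) (R₁₁ : Matrix (Fin k) (Fin k) 𝕜) (R₁₂ : Matrix (Fin k) (Fin k₁) 𝕜),
    IsSRRQR s C.transpose e f Q R₁₁ R₁₂ ∧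
    (∀ t, (e (Sum.inl t) : Fin n) = g t) ∧
    U = (Matrix.fromRows 1 (R₁₁⁻¹ * R₁₂).transpose).submatrix e.symm g.symm

/-- The data computed by a run of the construction, at the nodes of levels `2, …, L`
(depths `k` with `0 < k < L`; data at other depths are irrelevant), for the matrix `A`,
the row points `x`, the column points `y`, separation ratio `τ`, SRRQR bound `s`
and tolerances `εsvd`, `εfar`. -/
structure Run (T : Partition d L) (A : Matrix (Fin n) (Fin n) 𝕜)
    (x y : Fin n → EuclideanSpace ℝ (Fin d)) (τ s εsvd εfar : ℝ) where
  /-- The selected row indices `î`. -/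
  rowHat : (k : ℕ) → Node k → Finset (Fin n)
  /-- The selected column indices `î`. -/
  colHat : (k : ℕ) → Node k → Finset (Fin n)
  rowDim : (k : ℕ) → Node k → ℕ
  colDim : (k : ℕ) → Node k → ℕ
  /-- The farfield column basis `Û` of a node. -/
  rowBasis : (k : ℕ) → (i : Node k) → Matrix (bar T x rowHat k i) (Fin (rowDim k i)) 𝕜
  /-- The farfield row basis `V̂` of a node. -/
  colBasis : (k : ℕ) → (i : Node k) → Matrix (bar T y colHat k i) (Fin (colDim k i)) 𝕜
  /-- The truncated SVD of the nearfield block row of a node. -/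
  rowSVD : (k : ℕ) → (i : Node k) →
    TruncatedSVD (nearRow A (bar T x rowHat k i) (nearfield T τ k i) (bar T y colHat k))
  /-- The truncated SVD of the transposed nearfield block column of a node. -/
  colSVD : (k : ℕ) → (i : Node k) →
    TruncatedSVD (nearRow A.transpose (bar T y colHat k i) (nearfield T τ k i) (bar T x rowHat k))
  /-- `P_i [1; G_i]`, which is `U_i` at a leaf and `[R_{c₁}; R_{c₂}]` at a parent. -/
  U : (k : ℕ) → (i : Node k) → Matrix (bar T x rowHat k i) (rowHat k i) 𝕜
  /-- `F_i [1; H_i]`, which is `V_i` at a leaf and `[W_{c₁}; W_{c₂}]` at a parent. -/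
  V : (k : ℕ) → (i : Node k) → Matrix (bar T y colHat k i) (colHat k i) 𝕜
  /-- `εfar` is the tolerance of the farfield approximation. -/
  farfield : ∀ k, 0 < k → k < L → ∀ i j : Node k, WellSeparated τ (T.dom k i) (T.dom k j) →
    ∃ B : Matrix (Fin (rowDim k i)) (Fin (colDim k j)) 𝕜,
      maxNorm (block A (bar T x rowHat k i) (bar T y colHat k j) -
          rowBasis k i * B * (colBasis k j).transpose) ≤
        εfar * maxNorm (block A (bar T x rowHat k i) (bar T y colHat k j))
  row_tolerance : ∀ k, 0 < k → k < L → ∀ i, (rowSVD k i).HasTolerance εsvd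
  col_tolerance : ∀ k, 0 < k → k < L → ∀ i, (colSVD k i).HasTolerance εsvd
  row_compr : ∀ k, 0 < k → k < L → ∀ i,
    IsCompr s (Matrix.fromCols (rowBasis k i) (rowSVD k i).S) (rowHat k i) (U k i)
  col_compr : ∀ k, 0 < k → k < L → ∀ i,
    IsCompr s (Matrix.fromCols (colBasis k i) (colSVD k i).S) (colHat k i) (V k i)

/-! ### The telescoping factorization -/

/-- The indices left after the compression at depth `k`; all indices if `k ≥ L`. Thus the level
matrices at depth `k` have rows in `remaining L hat (k + 1)`, which is the union of the index sets
`ī` of that depth, and columns in `remaining L hat k`. -/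
def remaining (L : ℕ) (hat : (k : ℕ) → Node k → Finset (Fin n)) (k : ℕ) : Finset (Fin n) :=
  if k < L then Finset.univ.biUnion (hat k) else Finset.univ

theorem mem_remaining_last (L : ℕ) (hat : (k : ℕ) → Node k → Finset (Fin n)) (a : Fin n) :
    a ∈ remaining L hat (L - 1 + 1) := by
  have h : ¬ (L - 1 + 1 < L) := by omega
  simp [remaining, h]

/-- The matrix with rows in `I₀` and columns in `J₀` whose `I × J` block is `M` and whose other
entries vanish. -/
def placeBlock (I₀ J₀ : Finset (Fin n)) {I J : Finset (Fin n)} (M : Matrix I J 𝕜) :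
    Matrix I₀ J₀ 𝕜 :=
  Matrix.of fun a b => if h : a.1 ∈ I ∧ b.1 ∈ J then M ⟨a.1, h.1⟩ ⟨b.1, h.2⟩ else 0

namespace Run

variable {T : Partition d L} {A : Matrix (Fin n) (Fin n) 𝕜}
  {x y : Fin n → EuclideanSpace ℝ (Fin d)} {τ s εsvd εfar : ℝ}

/-- The block diagonal matrix `U^{(k+1)}`. -/
noncomputable def levelU (R : Run T A x y τ s εsvd εfar) (k : ℕ) :
    Matrix (remaining L R.rowHat (k + 1)) (remaining L R.rowHat k) 𝕜 :=
  ∑ i : Node k, placeBlock _ _ (R.U k i)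

/-- The block diagonal matrix `V^{(k+1)}`. -/
noncomputable def levelV (R : Run T A x y τ s εsvd εfar) (k : ℕ) :
    Matrix (remaining L R.colHat (k + 1)) (remaining L R.colHat k) 𝕜 :=
  ∑ i : Node k, placeBlock _ _ (R.V k i)

/-- The block diagonal matrix `B^{(k+1)}`, with diagonal blocks `[0 B_{c₁}; B_{c₂} 0]`, and `D_i`
at the leaf level. -/
noncomputable def levelB (R : Run T A x y τ s εsvd εfar) (k : ℕ) :
    Matrix (remaining L R.rowHat (k + 1)) (remaining L R.colHat (k + 1)) 𝕜 :=
  if k + 1 < L then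
    ∑ i : Node k,
      (placeBlock _ _ (block A (R.rowHat (k + 1) (i.child false))
          (R.colHat (k + 1) (i.child true))) +
        placeBlock _ _ (block A (R.rowHat (k + 1) (i.child true))
          (R.colHat (k + 1) (i.child false))))
  else
    ∑ i : Node k, placeBlock _ _ (block A (indicesIn x (T.dom k i)) (indicesIn y (T.dom k i)))

/-- The telescoping product down to depth `k`: `B^{(1)}` for `k = 0`, and then
`U^{(k+2)} (…) (V^{(k+2)})ᵀ + B^{(k+2)}`. -/
noncomputable def telescope (R : Run T A x y τ s εsvd εfar) : (k : ℕ) →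
    Matrix (remaining L R.rowHat (k + 1)) (remaining L R.colHat (k + 1)) 𝕜
  | 0 => R.levelB 0
  | k + 1 => R.levelU (k + 1) * R.telescope k * (R.levelV (k + 1)).transpose + R.levelB (k + 1)

/-- The `n × n` telescoping HSS factorization, all `L` levels. -/
noncomputable def hss (R : Run T A x y τ s εsvd εfar) : Matrix (Fin n) (Fin n) 𝕜 :=
  (R.telescope (L - 1)).submatrix
    (fun a => ⟨a, mem_remaining_last L R.rowHat a⟩) (fun b => ⟨b, mem_remaining_last L R.colHat b⟩)

end Run

end Construction

/-! ### The constants -/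

/-- `∑_{l=2}^{max(2, L-1)} 2^{L+l/2+2} s^{2L-2l+2} (r_{l+1} ⋯ r_L)² r_{l+1}^{3/2} r_l^{5/2}`. -/
noncomputable def constSVD (s : ℝ) (r : ℕ → ℕ) (L : ℕ) : ℝ :=
  ∑ l ∈ Finset.Icc 2 (max 2 (L - 1)),
    (2 : ℝ) ^ ((L : ℝ) + (l : ℝ) / 2 + 2) * s ^ (2 * (L - l) + 2) *
      (∏ t ∈ Finset.Icc (l + 1) L, (r t : ℝ)) ^ 2 *
      (r (l + 1) : ℝ) ^ (3 / 2 : ℝ) * (r l : ℝ) ^ (5 / 2 : ℝ)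

/-- `∑_{l=2}^{L} 2^{L+2} s^{2L-2l+2} (r_l r_{l+1} ⋯ r_L)² r_{l+1}`. -/
noncomputable def constFar (s : ℝ) (r : ℕ → ℕ) (L : ℕ) : ℝ :=
  ∑ l ∈ Finset.Icc 2 L,
    (2 : ℝ) ^ (L + 2) * s ^ (2 * (L - l) + 2) *
      (∏ t ∈ Finset.Icc l L, (r t : ℝ)) ^ 2 * (r (l + 1) : ℝ)

end SMASH

/-!
The selected rows of an SRRQR factorization reproduce the compressed matrix exactly: `C = U C_H`,
where `H` is the selected index set and the entries of `U` are at most `s` (`IsCompr.eq_mul`). So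
if a block of `A` is, up to a perturbation, in the column span of `C`, its interpolation from the
selected rows errs only by the perturbation and its interpolation (`frobNorm_interpolation_le`).
Applied to the rows and then to the columns, this bounds the error in a nearfield block by the
tolerance of the truncated SVDs; a farfield block is interpolated on both sides at once, with the
farfield tolerance (`frobNorm_near_error_le`, `frobNorm_far_error_le`). The blocks of one level lie
in disjoint rectangles, because the index sets of the nodes refine the partition of the domain, so
their squared Frobenius norms add up (`Run.frobNorm_levelError_le`).

All level matrices are extended by zero to `n × n` matrices. At each depth, the diagonal blocks
`B` and the off-diagonal blocks before compression are exactly the off-diagonal blocks after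
compression of the next depth, or all of `A` at the leaves (`Run.extend_levelB_add_offDiag`,
`Run.extend_levelB_add_offDiag_leaf`). Hence the errors satisfy
`Err_{k+1} = U Err_k Vᵀ + (error of the level)` with `Err_0 = 0` (`Run.telescopeError_succ`), where
`X ↦ U X Vᵀ` enlarges the Frobenius norm at most by the factor `2 s² r_l r_{l+1}`. Unrolling this
recursion gives the two sums; the nearfield error of the leaf level, for which `constSVD` has no
summand if `L ≥ 3`, fits into the slack of the summand before it (`sum_near_le`).
-/

namespace SMASH

/-! ### Norm estimates -/

section NormEstimates

variable {𝕜 : Type*} [RCLike 𝕜] {m c p : Type*} [Fintype m] [Fintype c] [Fintype p]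

theorem frobNorm_nonneg (M : Matrix m c 𝕜) : 0 ≤ frobNorm M := by
  unfold frobNorm
  rw [Matrix.frobenius_norm_def]
  positivity

theorem frobNorm_sq (M : Matrix m c 𝕜) : frobNorm M ^ 2 = ∑ a, ∑ b, ‖M a b‖ ^ 2 := by
  unfold frobNorm
  rw [Matrix.frobenius_norm_def, ← Real.sqrt_eq_rpow, Real.sq_sqrt (by positivity)]
  simp

@[simp] theorem frobNorm_zero : frobNorm (0 : Matrix m c 𝕜) = 0 := by
  have h : frobNorm (0 : Matrix m c 𝕜) ^ 2 = 0 := by simp [frobNorm_sq]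
  exact pow_eq_zero_iff two_ne_zero |>.1 h

theorem frobNorm_add_le (M N : Matrix m c 𝕜) : frobNorm (M + N) ≤ frobNorm M + frobNorm N := by
  unfold frobNorm
  exact @norm_add_le _ Matrix.frobeniusSeminormedAddCommGroup.toSeminormedAddGroup M N

theorem frobNorm_sub_le (M N : Matrix m c 𝕜) : frobNorm (M - N) ≤ frobNorm M + frobNorm N := by
  unfold frobNorm
  exact @norm_sub_le _ Matrix.frobeniusSeminormedAddCommGroup.toSeminormedAddGroup M N

theorem frobNorm_mul_le (M : Matrix m c 𝕜) (N : Matrix c p 𝕜) :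
    frobNorm (M * N) ≤ frobNorm M * frobNorm N := by
  unfold frobNorm
  exact Matrix.frobenius_norm_mul M N

@[simp] theorem frobNorm_transpose (M : Matrix m c 𝕜) : frobNorm M.transpose = frobNorm M := by
  unfold frobNorm
  exact Matrix.frobenius_norm_transpose M

theorem frobNorm_le_of_sq_le {M : Matrix m c 𝕜} {t : ℝ} (ht : 0 ≤ t)
    (h : frobNorm M ^ 2 ≤ t ^ 2) : frobNorm M ≤ t :=
  (sq_le_sq₀ (frobNorm_nonneg M) ht).1 h

theorem norm_entry_le_frobNorm (M : Matrix m c 𝕜) (a : m) (b : c) : ‖M a b‖ ≤ frobNorm M := by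
  refine (sq_le_sq₀ (norm_nonneg _) (frobNorm_nonneg M)).1 ?_
  rw [frobNorm_sq]
  calc ‖M a b‖ ^ 2 ≤ ∑ b, ‖M a b‖ ^ 2 :=
        Finset.single_le_sum (f := fun b => ‖M a b‖ ^ 2) (fun _ _ => by positivity)
          (Finset.mem_univ b)
    _ ≤ _ := Finset.single_le_sum (f := fun a => ∑ b, ‖M a b‖ ^ 2)
          (fun _ _ => by positivity) (Finset.mem_univ a)

theorem frobNorm_le_of_entry_le {M : Matrix m c 𝕜} {t : ℝ} (ht : 0 ≤ t)
    (h : ∀ a b, ‖M a b‖ ≤ t) :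
    frobNorm M ≤ √((Fintype.card m : ℝ) * Fintype.card c) * t := by
  refine frobNorm_le_of_sq_le (by positivity) ?_
  rw [frobNorm_sq, mul_pow, Real.sq_sqrt (by positivity)]
  calc ∑ a, ∑ b, ‖M a b‖ ^ 2 ≤ ∑ _a : m, ∑ _b : c, t ^ 2 := by
        gcongr with a _ b _
        exact h a b
    _ = _ := by simp [mul_assoc]

theorem frobNorm_submatrix_le {m' c' : Type*} [Fintype m'] [Fintype c'] (M : Matrix m c 𝕜)
    {f : m' → m} {g : c' → c} (hf : Function.Injective f) (hg : Function.Injective g) :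
    frobNorm (M.submatrix f g) ≤ frobNorm M := by
  refine frobNorm_le_of_sq_le (frobNorm_nonneg M) ?_
  rw [frobNorm_sq, frobNorm_sq]
  calc ∑ a, ∑ b, ‖M.submatrix f g a b‖ ^ 2 ≤ ∑ a, ∑ b, ‖M (f a) b‖ ^ 2 := by
        refine Finset.sum_le_sum fun a _ => ?_
        exact (Finset.sum_map Finset.univ ⟨g, hg⟩ fun b => ‖M (f a) b‖ ^ 2).symm.trans_le
          (Finset.sum_le_univ_sum_of_nonneg fun _ => by positivity)
    _ ≤ _ := (Finset.sum_map Finset.univ ⟨f, hf⟩ fun a => ∑ b, ‖M a b‖ ^ 2).symm.trans_le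
          (Finset.sum_le_univ_sum_of_nonneg fun _ => by positivity)

theorem norm_entry_le_maxNorm (M : Matrix m c 𝕜) (a : m) (b : c) : ‖M a b‖ ≤ maxNorm M := by
  have h := Finset.le_sup (f := fun p : m × c => ‖M p.1 p.2‖₊) (Finset.mem_univ (a, b))
  exact_mod_cast h

theorem maxNorm_le_frobNorm (M : Matrix m c 𝕜) : maxNorm M ≤ frobNorm M := by
  have h : (Finset.univ.sup fun p : m × c => ‖M p.1 p.2‖₊) ≤ ⟨frobNorm M, frobNorm_nonneg M⟩ :=
    Finset.sup_le fun p _ => norm_entry_le_frobNorm M p.1 p.2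
  exact_mod_cast h

theorem specNorm_le_frobNorm [DecidableEq c] (M : Matrix m c 𝕜) : specNorm M ≤ frobNorm M := by
  unfold specNorm
  rw [Matrix.l2_opNorm_def]
  refine ContinuousLinearMap.opNorm_le_bound _ (frobNorm_nonneg M) fun v => ?_
  have h := frobNorm_mul_le M (Matrix.replicateCol Unit v.ofLp)
  rw [← Matrix.replicateCol_mulVec] at h
  unfold frobNorm at h ⊢
  rw [Matrix.frobenius_norm_replicateCol, Matrix.frobenius_norm_replicateCol] at h
  exact h

end NormEstimates

/-! ### Extension of blocks by zero -/

section Extend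

variable {𝕜 : Type*} [RCLike 𝕜] {n : ℕ} {I J K : Finset (Fin n)}

/-- The `n × n` matrix whose `I × J` block is `M` and whose other entries vanish. The level
matrices have index sets that depend on the run; after extension by zero they all live in one
type. -/
def extend (M : Matrix I J 𝕜) : Matrix (Fin n) (Fin n) 𝕜 :=
  Matrix.of fun a b => if h : a ∈ I ∧ b ∈ J then M ⟨a, h.1⟩ ⟨b, h.2⟩ else 0

theorem extend_apply_mem (M : Matrix I J 𝕜) {a b : Fin n} (ha : a ∈ I) (hb : b ∈ J) :
    extend M a b = M ⟨a, ha⟩ ⟨b, hb⟩ := by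
  simp [extend, ha, hb]

theorem extend_apply_not_mem_left (M : Matrix I J 𝕜) {a : Fin n} (b : Fin n) (ha : a ∉ I) :
    extend M a b = 0 := by
  simp [extend, ha]

theorem extend_apply_not_mem_right (M : Matrix I J 𝕜) (a : Fin n) {b : Fin n} (hb : b ∉ J) :
    extend M a b = 0 := by
  simp [extend, hb]

theorem extend_block_apply (A : Matrix (Fin n) (Fin n) 𝕜) (a b : Fin n) :
    extend (block A I J) a b = if a ∈ I ∧ b ∈ J then A a b else 0 := by
  by_cases h : a ∈ I ∧ b ∈ J
  · rw [extend_apply_mem _ h.1 h.2, if_pos h]; rfl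
  · rw [if_neg h, extend, Matrix.of_apply, dif_neg h]

@[simp] theorem extend_zero : extend (0 : Matrix I J 𝕜) = 0 := by
  ext a b; simp [extend]

theorem extend_add (M N : Matrix I J 𝕜) : extend (M + N) = extend M + extend N := by
  ext a b
  by_cases h : a ∈ I ∧ b ∈ J <;> simp [extend, h]

theorem extend_sub (M N : Matrix I J 𝕜) : extend (M - N) = extend M - extend N := by
  ext a b
  by_cases h : a ∈ I ∧ b ∈ J <;> simp [extend, h]

theorem extend_sum {ι : Type*} (S : Finset ι) (M : ι → Matrix I J 𝕜) :
    extend (∑ i ∈ S, M i) = ∑ i ∈ S, extend (M i) := by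
  classical
  induction S using Finset.induction_on with
  | empty => simp
  | insert i S hi ih => rw [Finset.sum_insert hi, Finset.sum_insert hi, extend_add, ih]

theorem extend_transpose (M : Matrix I J 𝕜) : extend M.transpose = (extend M).transpose := by
  ext a b
  by_cases h : b ∈ I ∧ a ∈ J
  · simp [extend, h]
  · have h' : ¬ (a ∈ J ∧ b ∈ I) := fun h' => h h'.symm
    simp only [extend, Matrix.of_apply, Matrix.transpose_apply, dif_neg h, dif_neg h']

theorem extend_mul (M : Matrix I J 𝕜) (N : Matrix J K 𝕜) :
    extend (M * N) = extend M * extend N := by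
  ext a b
  rw [Matrix.mul_apply]
  by_cases ha : a ∈ I
  · by_cases hb : b ∈ K
    · rw [extend_apply_mem _ ha hb, Matrix.mul_apply]
      rw [← Finset.sum_subset (Finset.subset_univ J) (fun t _ ht => by
        rw [extend_apply_not_mem_right _ _ ht, zero_mul]), ← Finset.sum_coe_sort J]
      exact Finset.sum_congr rfl fun t _ => by
        rw [extend_apply_mem _ ha t.2, extend_apply_mem _ t.2 hb]
    · simp [extend_apply_not_mem_right _ _ hb]
  · simp [extend_apply_not_mem_left _ _ ha]

theorem extend_mul_extend_of_disjoint {J' : Finset (Fin n)} (h : Disjoint J J')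
    (M : Matrix I J 𝕜) (N : Matrix J' K 𝕜) : extend M * extend N = 0 := by
  ext a b
  rw [Matrix.mul_apply]
  refine Finset.sum_eq_zero fun t _ => ?_
  by_cases ht : t ∈ J
  · rw [extend_apply_not_mem_left N b (Finset.disjoint_left.1 h ht), mul_zero]
  · rw [extend_apply_not_mem_right M a ht, zero_mul]

theorem extend_mul_matrix (M : Matrix I J 𝕜) (X : Matrix (Fin n) (Fin n) 𝕜) :
    extend M * X = extend (M * block X J Finset.univ) := by
  rw [extend_mul]
  ext a b
  rw [Matrix.mul_apply, Matrix.mul_apply]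
  refine Finset.sum_congr rfl fun t _ => ?_
  by_cases ht : t ∈ J
  · rw [extend_block_apply, if_pos ⟨ht, Finset.mem_univ b⟩]
  · rw [extend_apply_not_mem_right M a ht, zero_mul, zero_mul]

theorem extend_placeBlock {I₀ J₀ : Finset (Fin n)} (hI : I ⊆ I₀) (hJ : J ⊆ J₀)
    (M : Matrix I J 𝕜) : extend (placeBlock I₀ J₀ M) = extend M := by
  ext a b
  by_cases h : a ∈ I ∧ b ∈ J
  · rw [extend_apply_mem _ (hI h.1) (hJ h.2), extend_apply_mem _ h.1 h.2]
    simp [placeBlock, h]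
  · by_cases h' : a ∈ I₀ ∧ b ∈ J₀
    · rw [extend_apply_mem _ h'.1 h'.2]
      simp [placeBlock, extend, h]
    · simp only [extend, Matrix.of_apply, dif_neg h, dif_neg h']

/-- Blocks on pairwise disjoint rectangles are orthogonal for the Frobenius inner product. -/
theorem frobNorm_sum_extend_sq {ι : Type*} (S : Finset ι) (I J : ι → Finset (Fin n))
    (hd : ∀ p ∈ S, ∀ q ∈ S, p ≠ q → Disjoint (I p) (I q) ∨ Disjoint (J p) (J q))
    (M : (p : ι) → Matrix (I p) (J p) 𝕜) :
    frobNorm (∑ p ∈ S, extend (M p)) ^ 2 = ∑ p ∈ S, frobNorm (M p) ^ 2 := by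
  have hentry : ∀ a b, ‖(∑ p ∈ S, extend (M p)) a b‖ ^ 2 = ∑ p ∈ S, ‖extend (M p) a b‖ ^ 2 := by
    intro a b
    rw [Matrix.sum_apply]
    by_cases h : ∃ p ∈ S, a ∈ I p ∧ b ∈ J p
    · obtain ⟨p, hp, ha, hb⟩ := h
      have hz : ∀ q ∈ S, q ≠ p → extend (M q) a b = 0 := by
        intro q hq hqp
        rcases hd q hq p hp hqp with h | h
        · exact extend_apply_not_mem_left _ _ fun ha' => Finset.disjoint_left.1 h ha' ha
        · exact extend_apply_not_mem_right _ _ fun hb' => Finset.disjoint_left.1 h hb' hb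
      rw [Finset.sum_eq_single_of_mem p hp hz,
        Finset.sum_eq_single_of_mem p hp fun q hq hqp => by simp [hz q hq hqp]]
    · have hz : ∀ q ∈ S, extend (M q) a b = 0 := fun q hq => by
        rw [extend, Matrix.of_apply, dif_neg fun hab => h ⟨q, hq, hab⟩]
      rw [Finset.sum_eq_zero hz, Finset.sum_eq_zero fun q hq => by simp [hz q hq]]
      simp
  have hone : ∀ p, frobNorm (M p) ^ 2 = ∑ a, ∑ b, ‖extend (M p) a b‖ ^ 2 := by
    intro p
    rw [frobNorm_sq, ← Finset.sum_subset (Finset.subset_univ (I p)) (fun a _ ha => by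
      simp [extend_apply_not_mem_left _ _ ha]), ← Finset.sum_coe_sort (I p)]
    refine Finset.sum_congr rfl fun a _ => ?_
    rw [← Finset.sum_subset (Finset.subset_univ (J p)) (fun b _ hb => by
      simp [extend_apply_not_mem_right _ _ hb]), ← Finset.sum_coe_sort (J p)]
    exact Finset.sum_congr rfl fun b _ => by rw [extend_apply_mem _ a.2 b.2]
  simp_rw [hone]
  rw [frobNorm_sq]
  simp_rw [hentry]
  rw [Finset.sum_comm]
  simp_rw [Finset.sum_comm (s := S)]
  rw [Finset.sum_comm]

theorem sum_frobNorm_block_sq_le {ι : Type*} (S : Finset ι) (I J : ι → Finset (Fin n))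
    (hd : ∀ p ∈ S, ∀ q ∈ S, p ≠ q → Disjoint (I p) (I q) ∨ Disjoint (J p) (J q))
    (A : Matrix (Fin n) (Fin n) 𝕜) :
    ∑ p ∈ S, frobNorm (block A (I p) (J p)) ^ 2 ≤ frobNorm A ^ 2 := by
  rw [← frobNorm_sum_extend_sq S I J hd, frobNorm_sq, frobNorm_sq]
  refine Finset.sum_le_sum fun a _ => Finset.sum_le_sum fun b _ => ?_
  gcongr
  rw [Matrix.sum_apply]
  simp_rw [extend_block_apply]
  by_cases h : ∃ p ∈ S, a ∈ I p ∧ b ∈ J p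
  · obtain ⟨p, hp, ha, hb⟩ := h
    rw [Finset.sum_eq_single_of_mem p hp, if_pos ⟨ha, hb⟩]
    intro q hq hqp
    rw [if_neg]
    rintro ⟨ha', hb'⟩
    rcases hd q hq p hp hqp with h | h
    · exact Finset.disjoint_left.1 h ha' ha
    · exact Finset.disjoint_left.1 h hb' hb
  · rw [Finset.sum_eq_zero fun q hq => if_neg fun hab => h ⟨q, hq, hab⟩]
    simp

/-- A block diagonal matrix acts on the left with the largest norm of its blocks. -/
theorem frobNorm_sum_extend_mul_le {ν : Type*} [Fintype ν] (I H : ν → Finset (Fin n))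
    (hI : ∀ i j, i ≠ j → Disjoint (I i) (I j)) (hH : ∀ i j, i ≠ j → Disjoint (H i) (H j))
    (U : (i : ν) → Matrix (I i) (H i) 𝕜) {t : ℝ} (ht : 0 ≤ t) (hU : ∀ i, frobNorm (U i) ≤ t)
    (X : Matrix (Fin n) (Fin n) 𝕜) :
    frobNorm ((∑ i, extend (U i)) * X) ≤ t * frobNorm X := by
  refine frobNorm_le_of_sq_le (mul_nonneg ht (frobNorm_nonneg X)) ?_
  rw [Finset.sum_mul]
  simp_rw [extend_mul_matrix]
  rw [frobNorm_sum_extend_sq Finset.univ I (fun _ => Finset.univ)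
    fun i _ j _ hij => Or.inl (hI i j hij)]
  calc ∑ i, frobNorm (U i * block X (H i) Finset.univ) ^ 2
      ≤ ∑ i, t ^ 2 * frobNorm (block X (H i) Finset.univ) ^ 2 := by
        refine Finset.sum_le_sum fun i _ => ?_
        rw [← mul_pow]
        have := frobNorm_nonneg (U i * block X (H i) Finset.univ)
        have := frobNorm_nonneg (block X (H i) Finset.univ)
        gcongr
        refine (frobNorm_mul_le _ _).trans ?_
        gcongr
        exact hU i
    _ = t ^ 2 * ∑ i, frobNorm (block X (H i) Finset.univ) ^ 2 := by rw [Finset.mul_sum]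
    _ ≤ t ^ 2 * frobNorm X ^ 2 := by
        gcongr
        exact sum_frobNorm_block_sq_le Finset.univ H (fun _ => Finset.univ)
          (fun i _ j _ hij => Or.inl (hH i j hij)) X
    _ = (t * frobNorm X) ^ 2 := by rw [mul_pow]

end Extend

/-! ### Compression by strong rank-revealing QR -/

section Compression

variable {𝕜 : Type*} [RCLike 𝕜] {n : ℕ}

/-- The inclusion of an index set into a larger one, as a map of index types. -/
def inclusion {H I : Finset (Fin n)} (h : H ⊆ I) (a : H) : I := ⟨a.1, h a.2⟩

theorem inclusion_injective {H I : Finset (Fin n)} (h : H ⊆ I) :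
    Function.Injective (inclusion h) := fun a b hab => by
  have : a.1 = b.1 := congrArg (fun z : I => z.1) hab
  exact Subtype.ext this

variable {s : ℝ} {I H : Finset (Fin n)} {p : Type*} [Fintype p] [DecidableEq p]
  {C : Matrix I p 𝕜} {U : Matrix I H 𝕜}

theorem IsCompr.subset (h : IsCompr s C H U) : H ⊆ I := by
  obtain ⟨k, k₁, k₂, e, f, g, Q, R₁₁, R₁₂, -, hg, -⟩ := h
  intro a ha
  have := hg (g.symm ⟨a, ha⟩)
  rw [Equiv.apply_symm_apply] at this
  rw [← show _ = a from this]
  exact (e _).2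

theorem IsCompr.norm_entry_le (h : IsCompr s C H U) (hs : 1 < s) (a : I) (b : H) :
    ‖U a b‖ ≤ s := by
  obtain ⟨k, k₁, k₂, e, f, g, Q, R₁₁, R₁₂, hQR, -, rfl⟩ := h
  rw [Matrix.submatrix_apply]
  rcases e.symm a with t | t
  · rw [Matrix.fromRows_apply_inl, Matrix.one_apply]
    split_ifs
    · simpa using hs.le
    · simpa using (zero_lt_one.trans hs).le
  · exact hQR.bound _ _

/-- The selected rows reproduce the compressed matrix exactly, since the SRRQR has a vanishing
trailing block. -/
theorem IsCompr.eq_mul (h : IsCompr s C H U) :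
    C = U * C.submatrix (inclusion h.subset) id := by
  have hsub := h.subset
  change C = U * C.submatrix (inclusion hsub) id
  obtain ⟨k, k₁, k₂, e, f, g, Q, R₁₁, R₁₂, hQR, hg, rfl⟩ := h
  set X := R₁₁⁻¹ * R₁₂ with hX
  have hR : R₁₂ = R₁₁ * X := by
    rw [hX, ← Matrix.mul_assoc, Matrix.mul_nonsing_inv _ hQR.invertible, Matrix.one_mul]
  have hinl : ∀ b t, C (e (Sum.inl t)) b =
      ∑ u, Q b (f (Sum.inl u)) * R₁₁ u t := by
    intro b t
    have := congrFun (congrFun hQR.factorization b) (Sum.inl t)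
    rw [Matrix.submatrix_apply, Matrix.transpose_apply, Matrix.mul_apply, ← f.sum_comp,
      Fintype.sum_sum_type] at this
    simpa using this
  have hinr : ∀ b t, C (e (Sum.inr t)) b =
      ∑ u, Q b (f (Sum.inl u)) * R₁₂ u t := by
    intro b t
    have := congrFun (congrFun hQR.factorization b) (Sum.inr t)
    rw [Matrix.submatrix_apply, Matrix.transpose_apply, Matrix.mul_apply, ← f.sum_comp,
      Fintype.sum_sum_type] at this
    simpa using this
  have hincl : ∀ u, inclusion hsub (g u) = e (Sum.inl u) := fun u =>
    Subtype.ext (hg u).symm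
  ext a b
  rw [Matrix.mul_apply, ← g.sum_comp]
  simp only [Matrix.submatrix_apply, Equiv.symm_apply_apply, hincl, id]
  obtain ⟨t, rfl⟩ := e.surjective a
  rw [Equiv.symm_apply_apply]
  rcases t with t | t
  · simp [Matrix.one_apply]
  · simp only [Matrix.fromRows_apply_inr, Matrix.transpose_apply, hinr, hinl, Finset.mul_sum]
    rw [Finset.sum_comm]
    refine Finset.sum_congr rfl fun u _ => ?_
    rw [hR, Matrix.mul_apply, Finset.mul_sum]
    exact Finset.sum_congr rfl fun v _ => by ring

theorem IsCompr.frobNorm_le (h : IsCompr s C H U) (hs : 1 < s) :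
    frobNorm U ≤ s * √((I.card : ℝ) * H.card) := by
  have := frobNorm_le_of_entry_le (zero_lt_one.trans hs).le (h.norm_entry_le hs)
  simpa [mul_comm] using this

end Compression

section Cols

variable {𝕜 : Type*} [RCLike 𝕜] {n : ℕ} {s : ℝ} {I H : Finset (Fin n)}
  {p q : Type*} [Fintype p] [DecidableEq p] [Fintype q] [DecidableEq q]
  {C : Matrix I p 𝕜} {D : Matrix I q 𝕜} {U : Matrix I H 𝕜}

theorem IsCompr.eq_mul_left (h : IsCompr s (Matrix.fromCols C D) H U) :
    C = U * C.submatrix (inclusion h.subset) id := by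
  ext a b
  have := congrFun (congrFun h.eq_mul a) (Sum.inl b)
  simpa [Matrix.mul_apply] using this

theorem IsCompr.eq_mul_right (h : IsCompr s (Matrix.fromCols C D) H U) :
    D = U * D.submatrix (inclusion h.subset) id := by
  ext a b
  have := congrFun (congrFun h.eq_mul a) (Sum.inr b)
  simpa [Matrix.mul_apply] using this

end Cols

/-! ### The error of one block -/

section BlockError

variable {𝕜 : Type*} [RCLike 𝕜] {n : ℕ} {s : ℝ} {I H J G : Finset (Fin n)}

/-- Interpolation of a perturbation of a matrix whose columns are reproduced by `U`: only the
perturbation contributes to the error. -/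
theorem frobNorm_interpolation_le {c : Type*} [Fintype c] {hH : H ⊆ I} {U : Matrix I H 𝕜}
    {X Y : Matrix I c 𝕜} (hY : Y = U * Y.submatrix (inclusion hH) id) :
    frobNorm (X - U * X.submatrix (inclusion hH) id) ≤ (1 + frobNorm U) * frobNorm (X - Y) := by
  have h : X - U * X.submatrix (inclusion hH) id =
      (X - Y) - U * (X - Y).submatrix (inclusion hH) id := by
    rw [Matrix.submatrix_sub]
    simp only [Pi.sub_apply]
    rw [Matrix.mul_sub, ← hY]
    abel
  rw [h, add_mul, one_mul]
  refine (frobNorm_sub_le _ _).trans ?_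
  gcongr
  refine (frobNorm_mul_le _ _).trans ?_
  have := frobNorm_nonneg U
  gcongr
  exact frobNorm_submatrix_le _ (inclusion_injective hH) Function.injective_id

/-- The nearfield error of the row compression. -/
theorem frobNorm_near_error_le {ν : Type*} [DecidableEq ν] {A : Matrix (Fin n) (Fin n) 𝕜}
    {N : Set ν} [Fintype N] {J : ν → Finset (Fin n)} {U : Matrix I H 𝕜} {w : ℕ}
    {C : Matrix I (Fin w) 𝕜} {D : TruncatedSVD (nearRow A I N J)} {ε : ℝ} (hε : 0 ≤ ε)
    (hD : D.HasTolerance ε)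
    (h : IsCompr s (Matrix.fromCols C D.S) H U) {t m : ℝ} (ht : frobNorm U ≤ t)
    (hm : 0 ≤ m) (hI : (I.card : ℝ) ≤ m) (hJ : ∀ j, ((J j).card : ℝ) ≤ m) (j : N) :
    frobNorm (block A I (J j) - U * block A H (J j)) ≤
      (1 + t) * (m * ε * frobNorm (nearRow A I N J)) := by
  let σ : J j.1 → Σ j : N, J j.1 := fun b => ⟨j, b⟩
  let Y : Matrix I (J j.1) 𝕜 :=
    (D.S * (Matrix.diagonal fun t => (D.sing t : 𝕜)) * D.Z).submatrix id σ
  have hY : Y = U * Y.submatrix (inclusion h.subset) id := by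
    have h1 : Y = D.S * ((Matrix.diagonal fun t => (D.sing t : 𝕜)) * D.Z).submatrix id σ := by
      rw [show Y = (D.S * (Matrix.diagonal fun t => (D.sing t : 𝕜)) * D.Z).submatrix id σ from rfl,
        Matrix.mul_assoc, Matrix.submatrix_mul _ _ id id σ Function.bijective_id,
        Matrix.submatrix_id_id]
    have h2 : Y.submatrix (inclusion h.subset) id = D.S.submatrix (inclusion h.subset) id *
        ((Matrix.diagonal fun t => (D.sing t : 𝕜)) * D.Z).submatrix id σ := by
      rw [h1, Matrix.submatrix_mul _ _ _ id id Function.bijective_id]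
      rfl
    rw [h2, ← Matrix.mul_assoc, ← h.eq_mul_right, ← h1]
  have hE : frobNorm (block A I (J j) - Y) ≤ m * ε * frobNorm (nearRow A I N J) := by
    have hsq : √((I.card : ℝ) * (J j.1).card) ≤ m := by
      rw [Real.sqrt_le_left hm, sq]
      exact mul_le_mul hI (hJ j) (Nat.cast_nonneg _) hm
    have := frobNorm_nonneg (nearRow A I N J)
    calc frobNorm (block A I (J j) - Y)
        ≤ √((I.card : ℝ) * (J j.1).card) * ε * specNorm (nearRow A I N J) := hD j
      _ ≤ √((I.card : ℝ) * (J j.1).card) * ε * frobNorm (nearRow A I N J) := by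
          gcongr
          exact specNorm_le_frobNorm _
      _ ≤ _ := by gcongr
  have hU := frobNorm_nonneg U
  refine (frobNorm_interpolation_le (X := block A I (J j)) hY).trans ?_
  exact mul_le_mul (by gcongr) hE (frobNorm_nonneg _) (by linarith)

/-- The farfield error of the compression of rows and columns. -/
theorem frobNorm_far_error_le {A : Matrix (Fin n) (Fin n) 𝕜} {U : Matrix I H 𝕜} {V : Matrix J G 𝕜}
    {w w' : ℕ} {C : Matrix I (Fin w) 𝕜} {C' : Matrix J (Fin w') 𝕜}
    {hH : H ⊆ I} {hG : G ⊆ J} (hC : C = U * C.submatrix (inclusion hH) id)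
    (hC' : C' = V * C'.submatrix (inclusion hG) id) {B : Matrix (Fin w) (Fin w') 𝕜}
    {ε : ℝ} (hε : 0 ≤ ε) (hs : 1 < s)
    (hB : maxNorm (block A I J - C * B * C'.transpose) ≤ ε * maxNorm (block A I J))
    (hU : frobNorm U ≤ s * √((I.card : ℝ) * H.card))
    (hV : frobNorm V ≤ s * √((J.card : ℝ) * G.card))
    {m q : ℝ} (hm : 0 ≤ m) (hq : 1 ≤ q) (hI : (I.card : ℝ) ≤ m) (hJ : (J.card : ℝ) ≤ m)
    (hHq : (H.card : ℝ) ≤ q) (hGq : (G.card : ℝ) ≤ q) :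
    frobNorm (block A I J - U * block A H G * V.transpose) ≤
      2 * m * s ^ 2 * q ^ 2 * ε * frobNorm (block A I J) := by
  set F := block A I J - C * B * C'.transpose with hF
  set b := ε * frobNorm (block A I J) with hb
  have hb0 : 0 ≤ b := mul_nonneg hε (frobNorm_nonneg _)
  have hFe : ∀ i j, ‖F i j‖ ≤ b := fun i j =>
    (norm_entry_le_maxNorm F i j).trans (hB.trans
      (mul_le_mul_of_nonneg_left (maxNorm_le_frobNorm _) hε))
  set F' : Matrix H G 𝕜 := F.submatrix (inclusion hH) (inclusion hG) with hF'
  have hF'e : ∀ i j, ‖F' i j‖ ≤ b := fun i j => hFe _ _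
  have h1 : frobNorm F ≤ √((I.card : ℝ) * J.card) * b := by
    simpa using frobNorm_le_of_entry_le hb0 hFe
  have h2 : frobNorm F' ≤ √((H.card : ℝ) * G.card) * b := by
    simpa using frobNorm_le_of_entry_le hb0 hF'e
  have hid : block A I J - U * block A H G * V.transpose = F - U * F' * V.transpose := by
    have h3 : F' = block A H G - C.submatrix (inclusion hH) id * B *
        (C'.submatrix (inclusion hG) id).transpose := by
      ext i j
      simp [hF', hF, block, Matrix.mul_apply, inclusion]
    have h4 : U * (C.submatrix (inclusion hH) id * B *
        (C'.submatrix (inclusion hG) id).transpose) * V.transpose = C * B * C'.transpose := by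
      conv_rhs => rw [hC, hC', Matrix.transpose_mul]
      simp only [Matrix.mul_assoc]
    rw [h3, Matrix.mul_sub, Matrix.sub_mul, h4, hF]
    abel
  clear hC hC'
  have hs0 : 0 < s := zero_lt_one.trans hs
  have hIJ : √((I.card : ℝ) * J.card) ≤ m := by
    rw [Real.sqrt_le_left hm, sq]
    exact mul_le_mul hI hJ (Nat.cast_nonneg _) hm
  have hprod : √((I.card : ℝ) * H.card) * √((H.card : ℝ) * G.card) * √((J.card : ℝ) * G.card) =
      √((I.card : ℝ) * J.card) * (H.card * G.card) := by
    rw [← Real.sqrt_mul (by positivity), ← Real.sqrt_mul (by positivity),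
      show (I.card : ℝ) * H.card * (H.card * G.card) * (J.card * G.card) =
        (I.card * J.card) * (H.card * G.card) ^ 2 by ring,
      Real.sqrt_mul (by positivity), Real.sqrt_sq (by positivity)]
  have hUFV : frobNorm (U * F' * V.transpose) ≤ s ^ 2 * (m * q ^ 2) * b := by
    have := frobNorm_nonneg U
    have := frobNorm_nonneg V
    have := frobNorm_nonneg F'
    calc frobNorm (U * F' * V.transpose)
        ≤ frobNorm U * frobNorm F' * frobNorm V := by
          refine (frobNorm_mul_le _ _).trans ?_
          rw [frobNorm_transpose]
          gcongr
          exact frobNorm_mul_le _ _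
      _ ≤ (s * √((I.card : ℝ) * H.card)) * (√((H.card : ℝ) * G.card) * b) *
            (s * √((J.card : ℝ) * G.card)) := by gcongr
      _ = s ^ 2 * (√((I.card : ℝ) * H.card) * √((H.card : ℝ) * G.card) *
            √((J.card : ℝ) * G.card)) * b := by ring
      _ ≤ s ^ 2 * (m * q ^ 2) * b := by
          rw [hprod, sq q]
          gcongr
  have hone : 1 ≤ s ^ 2 * q ^ 2 := by
    have h1 : (1 : ℝ) ≤ s ^ 2 := one_le_pow₀ hs.le
    have h2 : (1 : ℝ) ≤ q ^ 2 := one_le_pow₀ hq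
    exact one_le_mul_of_one_le_of_one_le h1 h2
  rw [hid]
  calc frobNorm (F - U * F' * V.transpose) ≤ m * b + s ^ 2 * (m * q ^ 2) * b :=
        (frobNorm_sub_le _ _).trans (add_le_add (h1.trans (by gcongr)) hUFV)
    _ = 1 * (m * b) + s ^ 2 * q ^ 2 * (m * b) := by ring
    _ ≤ s ^ 2 * q ^ 2 * (m * b) + s ^ 2 * q ^ 2 * (m * b) := by gcongr
    _ = _ := by rw [hb]; ring

end BlockError

/-! ### Index sets along the tree -/

section Tree

variable {d n L : ℕ}

theorem card_node : ∀ k, Fintype.card (Node k) = 2 ^ k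
  | 0 => rfl
  | k + 1 => by
    have h : Fintype.card (Node (k + 1)) = Fintype.card (Node k × Bool) := rfl
    rw [h, Fintype.card_prod, card_node k, Fintype.card_bool, pow_succ]

theorem Partition.disjoint_dom (T : Partition d L) : ∀ k, k < L → ∀ i j : Node k, i ≠ j →
    Disjoint (T.dom k i) (T.dom k j)
  | 0, _, i, j, hij => (hij rfl).elim
  | k + 1, hk, (i, b), (j, c), hij => by
    have hsub : ∀ (i : Node k) (b : Bool), T.dom (k + 1) (i, b) ⊆ T.dom k i := by
      intro i b
      rw [← T.union_children k hk i]
      cases b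
      · exact Set.subset_union_left
      · exact Set.subset_union_right
    by_cases h : i = j
    · subst h
      have hd := T.disjoint_children k hk i
      cases b <;> cases c
      · exact (hij rfl).elim
      · exact hd
      · exact hd.symm
      · exact (hij rfl).elim
    · exact (T.disjoint_dom k (by omega) i j h).mono (hsub i b) (hsub j c)

theorem Partition.exists_mem_dom (T : Partition d L) {z : EuclideanSpace ℝ (Fin d)}
    (hz : z ∈ T.dom 0 ()) : ∀ k, k < L → ∃ i : Node k, z ∈ T.dom k i
  | 0, _ => ⟨(), hz⟩
  | k + 1, hk => by
    obtain ⟨i, hi⟩ := T.exists_mem_dom hz k (by omega)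
    rw [← T.union_children k hk i] at hi
    exact hi.elim (fun h => ⟨_, h⟩) fun h => ⟨_, h⟩

theorem mem_indicesIn {x : Fin n → EuclideanSpace ℝ (Fin d)}
    {S : Set (EuclideanSpace ℝ (Fin d))} {a : Fin n} : a ∈ indicesIn x S ↔ x a ∈ S := by
  simp [indicesIn]

variable {T : Partition d L} {x : Fin n → EuclideanSpace ℝ (Fin d)}
  {hat : (k : ℕ) → Node k → Finset (Fin n)}

theorem bar_of_lt {k : ℕ} (hk : k + 1 < L) (i : Node k) :
    bar T x hat k i = hat (k + 1) (i.child false) ∪ hat (k + 1) (i.child true) := if_pos hk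

theorem bar_leaf {k : ℕ} (hk : ¬ k + 1 < L) (i : Node k) :
    bar T x hat k i = indicesIn x (T.dom k i) := if_neg hk

theorem bar_subset_indicesIn
    (hsub : ∀ k, 0 < k → k < L → ∀ i, hat k i ⊆ bar T x hat k i) :
    ∀ m k, k + 1 + m = L → ∀ i : Node k, bar T x hat k i ⊆ indicesIn x (T.dom k i)
  | 0, k, hk, i => (bar_leaf (by omega) i).subset
  | m + 1, k, hk, i => by
    have hk1 : k + 1 < L := by omega
    rw [bar_of_lt hk1, ← T.union_children k hk1 i]
    refine Finset.union_subset (fun a ha => ?_) fun a ha => ?_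
    · exact mem_indicesIn.2 (Or.inl (mem_indicesIn.1
        (bar_subset_indicesIn hsub m (k + 1) (by omega) _ (hsub (k + 1) (by omega) hk1 _ ha))))
    · exact mem_indicesIn.2 (Or.inr (mem_indicesIn.1
        (bar_subset_indicesIn hsub m (k + 1) (by omega) _ (hsub (k + 1) (by omega) hk1 _ ha))))

theorem disjoint_bar (hsub : ∀ k, 0 < k → k < L → ∀ i, hat k i ⊆ bar T x hat k i)
    {k : ℕ} (hk : k < L) (i j : Node k) (hij : i ≠ j) :
    Disjoint (bar T x hat k i) (bar T x hat k j) := by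
  rw [Finset.disjoint_left]
  intro a hi hj
  have hm : k + 1 + (L - (k + 1)) = L := by omega
  exact Set.disjoint_left.1 (T.disjoint_dom k hk i j hij)
    (mem_indicesIn.1 (bar_subset_indicesIn hsub _ k hm i hi))
    (mem_indicesIn.1 (bar_subset_indicesIn hsub _ k hm j hj))

theorem disjoint_hat (hsub : ∀ k, 0 < k → k < L → ∀ i, hat k i ⊆ bar T x hat k i)
    {k : ℕ} (hk0 : 0 < k) (hk : k < L) (i j : Node k) (hij : i ≠ j) :
    Disjoint (hat k i) (hat k j) :=
  (disjoint_bar hsub hk i j hij).mono (hsub k hk0 hk i) (hsub k hk0 hk j)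

theorem hat_subset_remaining {k : ℕ} (hk : k < L) (i : Node k) :
    hat k i ⊆ remaining L hat k := by
  rw [remaining, if_pos hk]
  exact Finset.subset_biUnion_of_mem (hat k) (Finset.mem_univ i)

theorem bar_subset_remaining (k : ℕ) (i : Node k) :
    bar T x hat k i ⊆ remaining L hat (k + 1) := by
  by_cases hk : k + 1 < L
  · rw [bar_of_lt hk]
    exact Finset.union_subset (hat_subset_remaining hk _) (hat_subset_remaining hk _)
  · rw [remaining, if_neg hk]
    exact Finset.subset_univ _

end Tree

/-! ### The telescoping identity -/

section OffDiag

variable {𝕜 : Type*} [RCLike 𝕜] {n : ℕ}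

/-- The part of `A` in the rectangles `I i × J j` with `i ≠ j`. -/
def offDiag {ν : Type*} [Fintype ν] [DecidableEq ν] (A : Matrix (Fin n) (Fin n) 𝕜)
    (I J : ν → Finset (Fin n)) : Matrix (Fin n) (Fin n) 𝕜 :=
  ∑ i, ∑ j, if i = j then 0 else extend (block A (I i) (J j))

variable {I I' J J' : Finset (Fin n)}

theorem extend_block_union_left (A : Matrix (Fin n) (Fin n) 𝕜) (h : Disjoint I I') :
    extend (block A (I ∪ I') J) = extend (block A I J) + extend (block A I' J) := by
  ext a b
  simp only [Matrix.add_apply, extend_block_apply, Finset.mem_union]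
  have hd : a ∈ I → a ∉ I' := fun h1 => Finset.disjoint_left.1 h h1
  by_cases h1 : a ∈ I <;> by_cases h2 : a ∈ I' <;> by_cases h3 : b ∈ J <;> simp_all

theorem extend_block_union_right (A : Matrix (Fin n) (Fin n) 𝕜) (h : Disjoint J J') :
    extend (block A I (J ∪ J')) = extend (block A I J) + extend (block A I J') := by
  ext a b
  simp only [Matrix.add_apply, extend_block_apply, Finset.mem_union]
  have hd : b ∈ J → b ∉ J' := fun h1 => Finset.disjoint_left.1 h h1
  by_cases h1 : b ∈ J <;> by_cases h2 : b ∈ J' <;> by_cases h3 : a ∈ I <;> simp_all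

end OffDiag

namespace Run

variable {𝕜 : Type*} [RCLike 𝕜] {d n L : ℕ} {T : Partition d L} {A : Matrix (Fin n) (Fin n) 𝕜}
  {x y : Fin n → EuclideanSpace ℝ (Fin d)} {τ s εsvd εfar : ℝ}

theorem rowHat_subset (R : Run T A x y τ s εsvd εfar) (k : ℕ) (h0 : 0 < k) (hk : k < L)
    (i : Node k) : R.rowHat k i ⊆ bar T x R.rowHat k i := (R.row_compr k h0 hk i).subset

theorem colHat_subset (R : Run T A x y τ s εsvd εfar) (k : ℕ) (h0 : 0 < k) (hk : k < L)
    (i : Node k) : R.colHat k i ⊆ bar T y R.colHat k i := (R.col_compr k h0 hk i).subset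

theorem extend_levelU (R : Run T A x y τ s εsvd εfar) {k : ℕ} (hk : k < L) :
    extend (R.levelU k) = ∑ i, extend (R.U k i) := by
  rw [levelU, extend_sum]
  exact Finset.sum_congr rfl fun i _ =>
    extend_placeBlock (bar_subset_remaining k i) (hat_subset_remaining hk i) _

theorem extend_levelV (R : Run T A x y τ s εsvd εfar) {k : ℕ} (hk : k < L) :
    extend (R.levelV k) = ∑ i, extend (R.V k i) := by
  rw [levelV, extend_sum]
  exact Finset.sum_congr rfl fun i _ =>
    extend_placeBlock (bar_subset_remaining k i) (hat_subset_remaining hk i) _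

/-- The diagonal blocks of one level and its off-diagonal blocks make up the off-diagonal blocks
of the next level. -/
theorem extend_levelB_add_offDiag (R : Run T A x y τ s εsvd εfar) {k : ℕ} (hk : k + 1 < L) :
    extend (R.levelB k) + offDiag A (bar T x R.rowHat k) (bar T y R.colHat k) =
      offDiag A (R.rowHat (k + 1)) (R.colHat (k + 1)) := by
  have hB : extend (R.levelB k) = ∑ i : Node k, ∑ j : Node k, if i = j then
      extend (block A (R.rowHat (k + 1) (i.child false)) (R.colHat (k + 1) (j.child true))) +
      extend (block A (R.rowHat (k + 1) (i.child true)) (R.colHat (k + 1) (j.child false)))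
      else 0 := by
    rw [levelB, if_pos hk, extend_sum]
    refine Finset.sum_congr rfl fun i _ => ?_
    rw [Finset.sum_ite_eq, if_pos (Finset.mem_univ i), extend_add,
      extend_placeBlock (hat_subset_remaining hk _) (hat_subset_remaining hk _),
      extend_placeBlock (hat_subset_remaining hk _) (hat_subset_remaining hk _)]
  have hH : offDiag A (R.rowHat (k + 1)) (R.colHat (k + 1)) =
      ∑ i : Node k, ∑ b : Bool, ∑ j : Node k, ∑ c : Bool,
        if i.child b = j.child c then 0 else
          extend (block A (R.rowHat (k + 1) (i.child b)) (R.colHat (k + 1) (j.child c))) := by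
    refine (Fintype.sum_prod_type (α₁ := Node k) (α₂ := Bool) _).trans ?_
    refine Finset.sum_congr rfl fun i _ => Finset.sum_congr rfl fun b _ => ?_
    exact Fintype.sum_prod_type (α₁ := Node k) (α₂ := Bool) _
  rw [hB, hH, offDiag, ← Finset.sum_add_distrib]
  refine Finset.sum_congr rfl fun i _ => ?_
  rw [Finset.sum_comm, ← Finset.sum_add_distrib]
  refine Finset.sum_congr rfl fun j _ => ?_
  simp only [Fintype.sum_bool]
  have hinj : ∀ b c, i.child b = j.child c ↔ i = j ∧ b = c := fun b c => Prod.ext_iff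
  have hne : ∀ i : Node k, i.child false ≠ i.child true := fun i h =>
    Bool.false_ne_true (congrArg (fun z : Node k × Bool => z.2) h)
  simp only [hinj]
  by_cases hij : i = j
  · simp [hij, add_comm]
  · simp only [hij, false_and, if_false, zero_add]
    rw [bar_of_lt hk, bar_of_lt hk,
      extend_block_union_left _ (disjoint_hat R.rowHat_subset k.succ_pos hk _ _ (hne i)),
      extend_block_union_right _ (disjoint_hat R.colHat_subset k.succ_pos hk _ _ (hne j)),
      extend_block_union_right _ (disjoint_hat R.colHat_subset k.succ_pos hk _ _ (hne j))]
    abel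

/-- At the leaf level, diagonal and off-diagonal blocks make up the whole matrix. -/
theorem extend_levelB_add_offDiag_leaf (R : Run T A x y τ s εsvd εfar) {k : ℕ} (hk : k + 1 = L)
    (hx : ∀ a, x a ∈ T.dom 0 ()) (hy : ∀ b, y b ∈ T.dom 0 ()) :
    extend (R.levelB k) + offDiag A (bar T x R.rowHat k) (bar T y R.colHat k) = A := by
  have hk' : ¬ k + 1 < L := by omega
  have hsub : ∀ {z : Fin n → EuclideanSpace ℝ (Fin d)} {hat : (k : ℕ) → Node k → Finset (Fin n)}
      (i : Node k), indicesIn z (T.dom k i) ⊆ remaining L hat (k + 1) := fun i => by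
    rw [remaining, if_neg hk']
    exact Finset.subset_univ _
  have hB : extend (R.levelB k) = ∑ i : Node k, ∑ j : Node k, if i = j then
      extend (block A (indicesIn x (T.dom k i)) (indicesIn y (T.dom k j))) else 0 := by
    rw [levelB, if_neg hk', extend_sum]
    refine Finset.sum_congr rfl fun i _ => ?_
    rw [Finset.sum_ite_eq, if_pos (Finset.mem_univ i), extend_placeBlock (hsub _) (hsub _)]
  have hsum : extend (R.levelB k) + offDiag A (bar T x R.rowHat k) (bar T y R.colHat k) =
      ∑ i : Node k, ∑ j : Node k,
        extend (block A (indicesIn x (T.dom k i)) (indicesIn y (T.dom k j))) := by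
    rw [hB, offDiag, ← Finset.sum_add_distrib]
    refine Finset.sum_congr rfl fun i _ => ?_
    rw [← Finset.sum_add_distrib]
    refine Finset.sum_congr rfl fun j _ => ?_
    rw [bar_leaf hk', bar_leaf hk']
    split_ifs <;> simp
  rw [hsum]
  have huniq : ∀ {z : EuclideanSpace ℝ (Fin d)} {i j : Node k}, z ∈ T.dom k i → z ∈ T.dom k j →
      j = i := fun hi hj => by
    by_contra h
    exact Set.disjoint_left.1 (T.disjoint_dom k (by omega) _ _ h) hj hi
  ext a b
  obtain ⟨i, hi⟩ := T.exists_mem_dom (hx a) k (by omega)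
  obtain ⟨j, hj⟩ := T.exists_mem_dom (hy b) k (by omega)
  simp only [Matrix.sum_apply, extend_block_apply]
  rw [Finset.sum_eq_single i, Finset.sum_eq_single j,
    if_pos ⟨mem_indicesIn.2 hi, mem_indicesIn.2 hj⟩]
  · exact fun j' _ hne => if_neg fun h => hne (huniq hj (mem_indicesIn.1 h.2))
  · simp
  · exact fun i' _ hne => Finset.sum_eq_zero fun j' _ =>
      if_neg fun h => hne (huniq hi (mem_indicesIn.1 h.1))
  · simp

/-- The error of the compression in the block of two nodes. -/
noncomputable def blockError (R : Run T A x y τ s εsvd εfar) (k : ℕ) (p : Node k × Node k) :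
    Matrix (bar T x R.rowHat k p.1) (bar T y R.colHat k p.2) 𝕜 :=
  block A (bar T x R.rowHat k p.1) (bar T y R.colHat k p.2) -
    R.U k p.1 * block A (R.rowHat k p.1) (R.colHat k p.2) * (R.V k p.2).transpose

/-- The error of the compression at depth `k`: the off-diagonal blocks before the compression
minus their interpolation from the selected rows and columns. -/
noncomputable def levelError (R : Run T A x y τ s εsvd εfar) (k : ℕ) :
    Matrix (Fin n) (Fin n) 𝕜 :=
  ∑ i, ∑ j, if i = j then 0 else extend (R.blockError k (i, j))

theorem offDiag_bar_eq (R : Run T A x y τ s εsvd εfar) {k : ℕ} (h0 : 0 < k) (hk : k < L) :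
    offDiag A (bar T x R.rowHat k) (bar T y R.colHat k) =
      extend (R.levelU k) * offDiag A (R.rowHat k) (R.colHat k) *
        (extend (R.levelV k)).transpose + R.levelError k := by
  have hUHV : extend (R.levelU k) * offDiag A (R.rowHat k) (R.colHat k) *
      (extend (R.levelV k)).transpose = ∑ i, ∑ j, if i = j then 0 else
        extend (R.U k i * block A (R.rowHat k i) (R.colHat k j) * (R.V k j).transpose) := by
    rw [R.extend_levelU hk, R.extend_levelV hk, offDiag, Finset.mul_sum, Finset.sum_mul]
    refine Finset.sum_congr rfl fun i _ => ?_
    rw [Finset.mul_sum, Finset.sum_mul]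
    refine Finset.sum_congr rfl fun j _ => ?_
    split_ifs with hij
    · simp
    · rw [Matrix.transpose_sum, Finset.sum_mul, Finset.sum_eq_single i, Finset.mul_sum,
        Finset.sum_eq_single j, extend_mul, extend_mul, extend_transpose]
      · intro j' _ hj'
        rw [← extend_mul, ← extend_transpose]
        exact extend_mul_extend_of_disjoint
          (disjoint_hat R.colHat_subset h0 hk _ _ hj'.symm) _ _
      · simp
      · intro i' _ hi'
        exact extend_mul_extend_of_disjoint (disjoint_hat R.rowHat_subset h0 hk _ _ hi') _ _
      · simp
  rw [hUHV, offDiag, levelError, ← Finset.sum_add_distrib]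
  refine Finset.sum_congr rfl fun i _ => ?_
  rw [← Finset.sum_add_distrib]
  refine Finset.sum_congr rfl fun j _ => ?_
  split_ifs
  · simp
  · rw [blockError, extend_sub]; abel

/-- What the telescoping product down to depth `k` misses. -/
noncomputable def telescopeError (R : Run T A x y τ s εsvd εfar) (k : ℕ) :
    Matrix (Fin n) (Fin n) 𝕜 :=
  extend (R.levelB k) + offDiag A (bar T x R.rowHat k) (bar T y R.colHat k) -
    extend (R.telescope k)

theorem telescopeError_zero (R : Run T A x y τ s εsvd εfar) : R.telescopeError 0 = 0 := by
  have : offDiag A (bar T x R.rowHat 0) (bar T y R.colHat 0) = 0 := by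
    refine Finset.sum_eq_zero fun i _ => Finset.sum_eq_zero fun j _ => if_pos rfl
  rw [telescopeError, this, telescope]
  simp

theorem telescopeError_succ (R : Run T A x y τ s εsvd εfar) {k : ℕ} (hk : k + 1 < L) :
    R.telescopeError (k + 1) = extend (R.levelU (k + 1)) * R.telescopeError k *
      (extend (R.levelV (k + 1))).transpose + R.levelError (k + 1) := by
  rw [telescopeError, telescopeError, R.offDiag_bar_eq k.succ_pos hk,
    R.extend_levelB_add_offDiag hk, telescope, extend_add, extend_mul, extend_mul,
    extend_transpose, Matrix.mul_sub, Matrix.sub_mul]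
  abel

theorem hss_eq_extend (R : Run T A x y τ s εsvd εfar) :
    R.hss = extend (R.telescope (L - 1)) := by
  ext a b
  rw [extend_apply_mem _ (mem_remaining_last L R.rowHat a) (mem_remaining_last L R.colHat b)]
  rfl

end Run

/-! ### The error of one level -/

theorem WellSeparated.symm {d : ℕ} {τ : ℝ} {S T : Set (EuclideanSpace ℝ (Fin d))}
    (h : WellSeparated τ S T) : WellSeparated τ T S := by
  obtain ⟨a, b, δa, δb, ha, hb, hS, hT, hle⟩ := h
  exact ⟨b, a, δb, δa, hb, ha, hT, hS, by rwa [add_comm, dist_comm]⟩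

section NearRow

variable {𝕜 : Type*} [RCLike 𝕜] {n : ℕ}

theorem frobNorm_nearRow_sq {ν : Type*} (A : Matrix (Fin n) (Fin n) 𝕜) (I : Finset (Fin n))
    (N : Set ν) [Fintype N] (J : ν → Finset (Fin n)) :
    frobNorm (nearRow A I N J) ^ 2 = ∑ j : N, frobNorm (block A I (J j)) ^ 2 := by
  rw [frobNorm_sq]
  simp_rw [frobNorm_sq, Fintype.sum_sigma]
  rw [Finset.sum_comm]
  rfl

theorem sum_frobNorm_nearRow_sq_le {ν : Type*} [Fintype ν] (A : Matrix (Fin n) (Fin n) 𝕜)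
    (I J : ν → Finset (Fin n)) (hI : ∀ i j, i ≠ j → Disjoint (I i) (I j))
    (hJ : ∀ i j, i ≠ j → Disjoint (J i) (J j)) (N : ν → Set ν) [∀ i, Fintype (N i)] :
    ∑ i, frobNorm (nearRow A (I i) (N i) J) ^ 2 ≤ frobNorm A ^ 2 := by
  calc ∑ i, frobNorm (nearRow A (I i) (N i) J) ^ 2
      ≤ ∑ i, ∑ j, frobNorm (block A (I i) (J j)) ^ 2 := by
        refine Finset.sum_le_sum fun i _ => ?_
        rw [frobNorm_nearRow_sq]
        exact (Finset.sum_map Finset.univ ⟨Subtype.val, Subtype.val_injective⟩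
          fun j => frobNorm (block A (I i) (J j)) ^ 2).symm.trans_le
          (Finset.sum_le_univ_sum_of_nonneg fun _ => by positivity)
    _ = ∑ p : ν × ν, frobNorm (block A (I p.1) (J p.2)) ^ 2 :=
        (Fintype.sum_prod_type fun p : ν × ν => frobNorm (block A (I p.1) (J p.2)) ^ 2).symm
    _ ≤ frobNorm A ^ 2 := by
        refine sum_frobNorm_block_sq_le Finset.univ (fun p : ν × ν => I p.1) (fun p => J p.2) ?_ A
        intro p _ q _ hpq
        by_cases h : p.1 = q.1
        · exact Or.inr (hJ _ _ fun h' => hpq (Prod.ext h h'))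
        · exact Or.inl (hI _ _ h)

/-- Blocks that are controlled by a quantity of their block row add up with the square root of the
number of block columns. -/
theorem frobNorm_sum_extend_le_of_row {ν : Type*} [Fintype ν] (S : Finset (ν × ν))
    {I J : ν → Finset (Fin n)} (hI : ∀ i j, i ≠ j → Disjoint (I i) (I j))
    (hJ : ∀ i j, i ≠ j → Disjoint (J i) (J j))
    (M : (p : ν × ν) → Matrix (I p.1) (J p.2) 𝕜) {t a : ℝ} (ht : 0 ≤ t) (ha : 0 ≤ a)
    {w : ν → ℝ} (hsum : ∑ i, w i ^ 2 ≤ a ^ 2)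
    (hM : (∀ p ∈ S, frobNorm (M p) ≤ t * w p.1) ∨ ∀ p ∈ S, frobNorm (M p) ≤ t * w p.2) :
    frobNorm (∑ p ∈ S, extend (M p)) ≤ t * √(Fintype.card ν) * a := by
  refine frobNorm_le_of_sq_le (by positivity) ?_
  rw [frobNorm_sum_extend_sq S (fun p => I p.1) (fun p => J p.2) ?_, mul_pow, mul_pow,
    Real.sq_sqrt (Nat.cast_nonneg _)]
  · have key : ∑ p ∈ S, frobNorm (M p) ^ 2 ≤ Fintype.card ν * ∑ i, (t * w i) ^ 2 := by
      rcases hM with hM | hM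
      · calc ∑ p ∈ S, frobNorm (M p) ^ 2 ≤ ∑ p ∈ S, (t * w p.1) ^ 2 :=
              Finset.sum_le_sum fun p hp => pow_le_pow_left₀ (frobNorm_nonneg _) (hM p hp) 2
          _ ≤ ∑ p : ν × ν, (t * w p.1) ^ 2 :=
              Finset.sum_le_univ_sum_of_nonneg fun _ => by positivity
          _ = _ := by simp [Fintype.sum_prod_type, Finset.mul_sum]
      · calc ∑ p ∈ S, frobNorm (M p) ^ 2 ≤ ∑ p ∈ S, (t * w p.2) ^ 2 :=
              Finset.sum_le_sum fun p hp => pow_le_pow_left₀ (frobNorm_nonneg _) (hM p hp) 2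
          _ ≤ ∑ p : ν × ν, (t * w p.2) ^ 2 :=
              Finset.sum_le_univ_sum_of_nonneg fun _ => by positivity
          _ = _ := by simp [Fintype.sum_prod_type]
    refine key.trans ?_
    simp_rw [mul_pow]
    rw [← Finset.mul_sum, ← mul_assoc, mul_comm (Fintype.card ν : ℝ)]
    gcongr
  · intro p _ q _ hpq
    by_cases h : p.1 = q.1
    · exact Or.inr (hJ _ _ fun h' => hpq (Prod.ext h h'))
    · exact Or.inl (hI _ _ h)

end NearRow

namespace Run

variable {𝕜 : Type*} [RCLike 𝕜] {d n L : ℕ} {T : Partition d L} {A : Matrix (Fin n) (Fin n) 𝕜}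
  {x y : Fin n → EuclideanSpace ℝ (Fin d)} {τ s εsvd εfar : ℝ}

variable (R : Run T A x y τ s εsvd εfar) {k : ℕ} {m q : ℝ}

theorem frobNorm_U_le (hs : 1 < s) (h0 : 0 < k) (hk : k < L)
    (hbar : ∀ i, ((bar T x R.rowHat k i).card : ℝ) ≤ m)
    (hhat : ∀ i, ((R.rowHat k i).card : ℝ) ≤ q) (i : Node k) :
    frobNorm (R.U k i) ≤ s * √(m * q) := by
  refine ((R.row_compr k h0 hk i).frobNorm_le hs).trans ?_
  have := (Nat.cast_nonneg _).trans (hbar i)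
  gcongr
  · exact hbar i
  · exact hhat i

theorem frobNorm_V_le (hs : 1 < s) (h0 : 0 < k) (hk : k < L)
    (hbar : ∀ i, ((bar T y R.colHat k i).card : ℝ) ≤ m)
    (hhat : ∀ i, ((R.colHat k i).card : ℝ) ≤ q) (i : Node k) :
    frobNorm (R.V k i) ≤ s * √(m * q) := by
  refine ((R.col_compr k h0 hk i).frobNorm_le hs).trans ?_
  have := (Nat.cast_nonneg _).trans (hbar i)
  gcongr
  · exact hbar i
  · exact hhat i

theorem frobNorm_far_le (hs : 1 < s) (hfar : 0 ≤ εfar) (h0 : 0 < k) (hk : k < L)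
    (hm : 0 ≤ m) (hq : 1 ≤ q)
    (hrbar : ∀ i, ((bar T x R.rowHat k i).card : ℝ) ≤ m)
    (hcbar : ∀ i, ((bar T y R.colHat k i).card : ℝ) ≤ m)
    (hrhat : ∀ i, ((R.rowHat k i).card : ℝ) ≤ q) (hchat : ∀ i, ((R.colHat k i).card : ℝ) ≤ q)
    (S : Finset (Node k × Node k))
    (hS : ∀ p ∈ S, WellSeparated τ (T.dom k p.1) (T.dom k p.2)) :
    frobNorm (∑ p ∈ S, extend (R.blockError k p)) ≤
      2 * m * s ^ 2 * q ^ 2 * εfar * frobNorm A := by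
  have hd : ∀ p ∈ S, ∀ p' ∈ S, p ≠ p' →
      Disjoint (bar T x R.rowHat k p.1) (bar T x R.rowHat k p'.1) ∨
        Disjoint (bar T y R.colHat k p.2) (bar T y R.colHat k p'.2) := by
    intro p _ p' _ hpq
    by_cases h : p.1 = p'.1
    · exact Or.inr (disjoint_bar R.colHat_subset hk _ _ fun h' => hpq (Prod.ext h h'))
    · exact Or.inl (disjoint_bar R.rowHat_subset hk _ _ h)
  refine frobNorm_le_of_sq_le (mul_nonneg (by positivity) (frobNorm_nonneg A)) ?_
  rw [frobNorm_sum_extend_sq S (fun p => bar T x R.rowHat k p.1)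
    (fun p => bar T y R.colHat k p.2) hd, mul_pow]
  refine le_trans ?_ (mul_le_mul_of_nonneg_left (sum_frobNorm_block_sq_le S
    (fun p => bar T x R.rowHat k p.1) (fun p => bar T y R.colHat k p.2) hd A) (by positivity))
  rw [Finset.mul_sum]
  refine Finset.sum_le_sum fun p hp => ?_
  rw [← mul_pow]
  refine pow_le_pow_left₀ (frobNorm_nonneg _) ?_ 2
  obtain ⟨B, hB⟩ := R.farfield k h0 hk p.1 p.2 (hS p hp)
  have hU := R.row_compr k h0 hk p.1
  have hV := R.col_compr k h0 hk p.2
  exact frobNorm_far_error_le hU.eq_mul_left hV.eq_mul_left hfar hs hB (hU.frobNorm_le hs)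
    (hV.frobNorm_le hs) hm hq (hrbar _) (hcbar _) (hrhat _) (hchat _)

/-- The nearfield blocks are interpolated first in the rows and then, on the selected rows, in the
columns. -/
theorem frobNorm_near_le (hs : 1 < s) (hsvd : 0 ≤ εsvd) (h0 : 0 < k) (hk : k < L)
    (hm : 0 ≤ m)
    (hrbar : ∀ i, ((bar T x R.rowHat k i).card : ℝ) ≤ m)
    (hcbar : ∀ i, ((bar T y R.colHat k i).card : ℝ) ≤ m)
    (hrhat : ∀ i, ((R.rowHat k i).card : ℝ) ≤ q) (hchat : ∀ i, ((R.colHat k i).card : ℝ) ≤ q)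
    (S : Finset (Node k × Node k))
    (hS : ∀ p ∈ S, p.1 ≠ p.2 ∧ ¬ WellSeparated τ (T.dom k p.1) (T.dom k p.2)) :
    frobNorm (∑ p ∈ S, extend (R.blockError k p)) ≤
      (1 + s * √(m * q)) ^ 2 * m * √(2 ^ k) * εsvd * frobNorm A := by
  have hs0 : 0 < s := zero_lt_one.trans hs
  set t := s * √(m * q) with ht
  have ht0 : 0 ≤ t := by positivity
  let Y : (p : Node k × Node k) → Matrix (bar T x R.rowHat k p.1) (bar T y R.colHat k p.2) 𝕜 :=
    fun p => block A (bar T x R.rowHat k p.1) (bar T y R.colHat k p.2) -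
      R.U k p.1 * block A (R.rowHat k p.1) (bar T y R.colHat k p.2)
  let Y' : (p : Node k × Node k) → Matrix (bar T y R.colHat k p.2) (bar T x R.rowHat k p.1) 𝕜 :=
    fun p => block A.transpose (bar T y R.colHat k p.2) (bar T x R.rowHat k p.1) -
      R.V k p.2 * block A.transpose (R.colHat k p.2) (bar T x R.rowHat k p.1)
  let Z : (p : Node k × Node k) → Matrix (R.rowHat k p.1) (bar T y R.colHat k p.2) 𝕜 :=
    fun p => block A (R.rowHat k p.1) (bar T y R.colHat k p.2) -
      block A (R.rowHat k p.1) (R.colHat k p.2) * (R.V k p.2).transpose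
  have hsplit : ∀ p, R.blockError k p = Y p + R.U k p.1 * Z p := by
    intro p
    simp only [blockError, Y, Z, Matrix.mul_sub, Matrix.mul_assoc]
    abel
  have hZ : ∀ p, frobNorm (Z p) ≤ frobNorm (Y' p) := by
    intro p
    have hsub := R.rowHat_subset k h0 hk p.1
    have : Z p = (Y' p).transpose.submatrix (inclusion hsub) id := by
      ext a b
      simp [Z, Y', block, Matrix.mul_apply, inclusion]
    rw [this, ← frobNorm_transpose (Y' p)]
    exact frobNorm_submatrix_le _ (inclusion_injective _) Function.injective_id
  have hI := disjoint_bar (T := T) R.rowHat_subset hk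
  have hJ := disjoint_bar (T := T) R.colHat_subset hk
  have hc : (Fintype.card (Node k) : ℝ) = 2 ^ k := by rw [card_node]; norm_cast
  have h1 : frobNorm (∑ p ∈ S, extend (Y p)) ≤
      ((1 + t) * (m * εsvd)) * √(2 ^ k) * frobNorm A := by
    rw [← hc]
    refine frobNorm_sum_extend_le_of_row S hI hJ Y (by positivity) (frobNorm_nonneg A)
      (sum_frobNorm_nearRow_sq_le A _ _ hI hJ (nearfield T τ k)) (Or.inl fun p hp => ?_)
    refine (frobNorm_near_error_le hsvd (R.row_tolerance k h0 hk p.1) (R.row_compr k h0 hk p.1)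
      (R.frobNorm_U_le hs h0 hk hrbar hrhat p.1) hm (hrbar _) hcbar
      ⟨p.2, (hS p hp).1.symm, (hS p hp).2⟩).trans_eq ?_
    rw [← ht]; ring
  have h2 : frobNorm (∑ p ∈ S, extend (R.U k p.1 * Z p)) ≤
      (t * ((1 + t) * (m * εsvd))) * √(2 ^ k) * frobNorm A := by
    rw [← hc, ← frobNorm_transpose A]
    refine frobNorm_sum_extend_le_of_row S hI hJ (fun p => R.U k p.1 * Z p) (by positivity)
      (frobNorm_nonneg _)
      (sum_frobNorm_nearRow_sq_le A.transpose _ _ hJ hI (nearfield T τ k)) (Or.inr fun p hp => ?_)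
    have hY' : frobNorm (Y' p) ≤ (1 + t) * (m * εsvd * _) :=
      frobNorm_near_error_le hsvd (R.col_tolerance k h0 hk p.2) (R.col_compr k h0 hk p.2)
        (R.frobNorm_V_le hs h0 hk hcbar hchat p.2) hm (hcbar _) hrbar
        ⟨p.1, (hS p hp).1, fun h => (hS p hp).2 h.symm⟩
    calc frobNorm (R.U k p.1 * Z p) ≤ frobNorm (R.U k p.1) * frobNorm (Z p) :=
          frobNorm_mul_le _ _
      _ ≤ t * ((1 + t) * (m * εsvd * _)) :=
          mul_le_mul (R.frobNorm_U_le hs h0 hk hrbar hrhat p.1) ((hZ p).trans hY')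
            (frobNorm_nonneg _) ht0
      _ = _ := by ring
  simp_rw [hsplit, extend_add, Finset.sum_add_distrib]
  refine (frobNorm_add_le _ _).trans ((add_le_add h1 h2).trans_eq ?_)
  ring

theorem frobNorm_levelError_le (hs : 1 < s) (hsvd : 0 ≤ εsvd) (hfar : 0 ≤ εfar)
    (h0 : 0 < k) (hk : k < L) (hm : 0 ≤ m) (hq : 1 ≤ q)
    (hrbar : ∀ i, ((bar T x R.rowHat k i).card : ℝ) ≤ m)
    (hcbar : ∀ i, ((bar T y R.colHat k i).card : ℝ) ≤ m)
    (hrhat : ∀ i, ((R.rowHat k i).card : ℝ) ≤ q) (hchat : ∀ i, ((R.colHat k i).card : ℝ) ≤ q) :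
    frobNorm (R.levelError k) ≤ (1 + s * √(m * q)) ^ 2 * m * √(2 ^ k) * εsvd * frobNorm A +
      2 * m * s ^ 2 * q ^ 2 * εfar * frobNorm A := by
  classical
  have h : R.levelError k =
      ∑ p ∈ Finset.univ.filter (fun p : Node k × Node k => p.1 ≠ p.2),
        extend (R.blockError k p) := by
    rw [Finset.sum_filter, Fintype.sum_prod_type, levelError]
    simp only [ne_eq, ite_not]
  rw [h, ← Finset.sum_filter_add_sum_filter_not _
    fun p => WellSeparated τ (T.dom k p.1) (T.dom k p.2), add_comm]
  refine (frobNorm_add_le _ _).trans (add_le_add ?_ ?_)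
  · refine R.frobNorm_near_le hs hsvd h0 hk hm hrbar hcbar hrhat hchat _ fun p hp => ?_
    rw [Finset.mem_filter, Finset.mem_filter] at hp
    exact ⟨hp.1.2, hp.2⟩
  · refine R.frobNorm_far_le hs hfar h0 hk hm hq hrbar hcbar hrhat hchat _ fun p hp => ?_
    exact (Finset.mem_filter.1 hp).2

/-- The level matrices amplify an error by the squared bound of their diagonal blocks. -/
theorem frobNorm_levelU_mul_levelV_le (hs : 1 < s) (h0 : 0 < k) (hk : k < L) (hm : 0 ≤ m)
    (hq : 0 ≤ q)
    (hrbar : ∀ i, ((bar T x R.rowHat k i).card : ℝ) ≤ m)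
    (hcbar : ∀ i, ((bar T y R.colHat k i).card : ℝ) ≤ m)
    (hrhat : ∀ i, ((R.rowHat k i).card : ℝ) ≤ q) (hchat : ∀ i, ((R.colHat k i).card : ℝ) ≤ q)
    (X : Matrix (Fin n) (Fin n) 𝕜) :
    frobNorm (extend (R.levelU k) * X * (extend (R.levelV k)).transpose) ≤
      s ^ 2 * (m * q) * frobNorm X := by
  have hs0 : 0 < s := zero_lt_one.trans hs
  have ht : 0 ≤ s * √(m * q) := by positivity
  rw [← frobNorm_transpose, Matrix.transpose_mul, Matrix.transpose_transpose,
    R.extend_levelU hk, R.extend_levelV hk]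
  refine (frobNorm_sum_extend_mul_le _ _ (disjoint_bar R.colHat_subset hk)
    (disjoint_hat R.colHat_subset h0 hk) _ ht (R.frobNorm_V_le hs h0 hk hcbar hchat) _).trans ?_
  rw [frobNorm_transpose]
  refine (mul_le_mul_of_nonneg_left (frobNorm_sum_extend_mul_le _ _
    (disjoint_bar R.rowHat_subset hk) (disjoint_hat R.rowHat_subset h0 hk) _ ht
    (R.frobNorm_U_le hs h0 hk hrbar hrhat) X) ht).trans_eq ?_
  calc s * √(m * q) * (s * √(m * q) * frobNorm X)
      = s ^ 2 * (√(m * q)) ^ 2 * frobNorm X := by ring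
    _ = _ := by rw [Real.sq_sqrt (by positivity)]

end Run

/-! ### Summation of the level errors -/

section Constants

variable {s : ℝ} {r : ℕ → ℕ} {L : ℕ}

/-- The bound for the factor by which the level matrices of the levels `l + 1, …, L` amplify an error
made at level `l`. -/
noncomputable def amplification (s : ℝ) (r : ℕ → ℕ) (L l : ℕ) : ℝ :=
  2 ^ (L - l) * s ^ (2 * (L - l)) *
    ((∏ t ∈ Finset.Icc (l + 1) L, (r t : ℝ)) * ∏ t ∈ Finset.Icc (l + 1) L, (r (t + 1) : ℝ))

theorem prod_Icc_eq_mul {l : ℕ} (f : ℕ → ℝ) (hl : l ≤ L) :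
    ∏ t ∈ Finset.Icc l L, f t = f l * ∏ t ∈ Finset.Icc (l + 1) L, f t := by
  rw [Finset.Icc_add_one_left_eq_Ioc, Finset.mul_prod_Ioc_eq_prod_Icc hl]

theorem amplification_last : amplification s r L L = 1 := by
  simp [amplification]

theorem amplification_nonneg (hs : 0 ≤ s) (l : ℕ) : 0 ≤ amplification s r L l := by
  unfold amplification
  positivity

/-- The amplification of a level is that of the next level times the bound
`Run.frobNorm_levelU_mul_levelV_le` of the next level matrices. -/
theorem amplification_eq {l : ℕ} (hl : l < L) :
    amplification s r L l =
      amplification s r L (l + 1) * (s ^ 2 * (2 * r (l + 2) * r (l + 1))) := by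
  unfold amplification
  rw [prod_Icc_eq_mul (fun t => (r t : ℝ)) (Nat.succ_le_of_lt hl),
    prod_Icc_eq_mul (fun t => (r (t + 1) : ℝ)) (Nat.succ_le_of_lt hl),
    show L - l = L - (l + 1) + 1 by omega,
    show 2 * (L - (l + 1) + 1) = 2 * (L - (l + 1)) + 2 by ring,
    pow_succ 2, pow_add s]
  ring

theorem amplification_le (hs : 0 ≤ s) (hr_anti : ∀ l, 2 ≤ l → l < L → r (l + 1) ≤ r l)
    (hr_last : r (L + 1) = r L) {l : ℕ} (hl : 2 ≤ l) :
    amplification s r L l ≤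
      2 ^ (L - l) * s ^ (2 * (L - l)) * (∏ t ∈ Finset.Icc (l + 1) L, (r t : ℝ)) ^ 2 := by
  unfold amplification
  rw [sq (∏ t ∈ _, _)]
  gcongr with t ht
  rw [Finset.mem_Icc] at ht
  rcases ht.2.lt_or_eq with h | h
  · exact hr_anti t (by omega) h
  · rw [h, hr_last]

/-- Unrolling the recursion: the error of the telescoping product is at most the sum of the level
errors, each amplified by the levels with larger index. -/
theorem amplified_le_sum {e δ : ℕ → ℝ} (hs : 0 ≤ s) (he : e 0 = 0)
    (hrec : ∀ k, k + 1 < L →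
      e (k + 1) ≤ s ^ 2 * (2 * r (k + 3) * r (k + 2)) * e k + δ (k + 2)) :
    ∀ k, k < L → amplification s r L (k + 1) * e k ≤
      ∑ l ∈ Finset.Icc 2 (k + 1), amplification s r L l * δ l
  | 0, _ => by simp [he]
  | k + 1, hk => by
    have ih := amplified_le_sum hs he hrec k (by omega)
    rw [Finset.sum_Icc_succ_top (by omega)]
    refine (mul_le_mul_of_nonneg_left (hrec k hk) (amplification_nonneg hs _)).trans ?_
    rw [mul_add, ← mul_assoc, ← amplification_eq hk]
    gcongr

theorem sum_far_le (hs : 0 ≤ s) (hr_anti : ∀ l, 2 ≤ l → l < L → r (l + 1) ≤ r l)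
    (hr_last : r (L + 1) = r L) :
    ∑ l ∈ Finset.Icc 2 L, amplification s r L l * (4 * s ^ 2 * r l ^ 2 * r (l + 1)) ≤
      constFar s r L := by
  refine Finset.sum_le_sum fun l hl => ?_
  rw [Finset.mem_Icc] at hl
  rw [prod_Icc_eq_mul (fun t => (r t : ℝ)) hl.2]
  have h2 : (2 : ℝ) ^ (L - l) ≤ 2 ^ L := pow_le_pow_right₀ (by norm_num) (by omega)
  calc amplification s r L l * (4 * s ^ 2 * r l ^ 2 * r (l + 1))
      ≤ (2 ^ L * s ^ (2 * (L - l)) * (∏ t ∈ Finset.Icc (l + 1) L, (r t : ℝ)) ^ 2) *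
          (4 * s ^ 2 * r l ^ 2 * r (l + 1)) := by
        gcongr
        exact (amplification_le hs hr_anti hr_last hl.1).trans (by gcongr)
    _ = _ := by
        rw [pow_add (2 : ℝ) L 2, pow_add s]
        ring

/-- The summand of `constSVD`, up to a factor `4 √r_l` that is at least `4`. -/
noncomputable def nearTerm (s : ℝ) (r : ℕ → ℕ) (L l : ℕ) : ℝ :=
  2 ^ L * √(2 ^ l) * s ^ (2 * (L - l) + 2) * (∏ t ∈ Finset.Icc (l + 1) L, (r t : ℝ)) ^ 2 *
    r (l + 1) ^ 2 * r l

theorem nearTerm_le {l : ℕ} (hs : 0 ≤ s) (hr : 0 < r l) (hle : r (l + 1) ≤ r l) :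
    4 * nearTerm s r L l ≤
      (2 : ℝ) ^ ((L : ℝ) + (l : ℝ) / 2 + 2) * s ^ (2 * (L - l) + 2) *
      (∏ t ∈ Finset.Icc (l + 1) L, (r t : ℝ)) ^ 2 *
      (r (l + 1) : ℝ) ^ (3 / 2 : ℝ) * (r l : ℝ) ^ (5 / 2 : ℝ) := by
  have h2 : (2 : ℝ) ^ ((L : ℝ) + (l : ℝ) / 2 + 2) = 2 ^ L * √(2 ^ l) * 4 := by
    rw [Real.rpow_add two_pos, Real.rpow_add two_pos, Real.rpow_natCast, Real.sqrt_eq_rpow,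
      ← Real.rpow_natCast 2 l, ← Real.rpow_mul two_pos.le]
    norm_num [div_eq_mul_inv]
  have hrpos : (0 : ℝ) < r l := by exact_mod_cast hr
  have h1 : (r (l + 1) : ℝ) ^ 2 * r l ≤
      (r (l + 1) : ℝ) ^ (3 / 2 : ℝ) * (r l : ℝ) ^ (5 / 2 : ℝ) := by
    have ha : (r (l + 1) : ℝ) ^ 2 =
        (r (l + 1) : ℝ) ^ (3 / 2 : ℝ) * (r (l + 1) : ℝ) ^ (1 / 2 : ℝ) := by
      rw [← Real.rpow_add_of_nonneg (Nat.cast_nonneg _) (by norm_num) (by norm_num),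
        ← Real.rpow_natCast]
      norm_num
    have hb : (r l : ℝ) ^ (5 / 2 : ℝ) = (r l : ℝ) ^ (1 / 2 : ℝ) * (r l : ℝ) ^ 2 := by
      rw [← Real.rpow_natCast, ← Real.rpow_add hrpos]
      norm_num
    have hc : (r (l + 1) : ℝ) ^ (1 / 2 : ℝ) ≤ (r l : ℝ) ^ (1 / 2 : ℝ) := by
      gcongr
    have hd : (r l : ℝ) ≤ (r l : ℝ) ^ 2 := by
      exact_mod_cast Nat.le_self_pow two_ne_zero _
    rw [ha, hb, mul_assoc]
    gcongr
  rw [h2, nearTerm]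
  calc _ = 2 ^ L * √(2 ^ l) * 4 * s ^ (2 * (L - l) + 2) *
        (∏ t ∈ Finset.Icc (l + 1) L, (r t : ℝ)) ^ 2 * ((r (l + 1) : ℝ) ^ 2 * r l) := by ring
    _ ≤ _ := by
      rw [mul_assoc _ ((r (l + 1) : ℝ) ^ (3 / 2 : ℝ))]
      gcongr

/-- The sum in `constSVD` stops one level before the leaves. Hence the nearfield error of the
leaf level has to be absorbed by the summand of the level before it: each level needs at most
`5 / 8` of its own summand, and the leaf level needs at most `3 / 8` of the summand before it. -/
theorem sum_near_le (hL : 2 ≤ L) (hs : 1 < s)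
    (hr_pos : ∀ l, 2 ≤ l → l ≤ L → 0 < r l)
    (hr_anti : ∀ l, 2 ≤ l → l < L → r (l + 1) ≤ r l) (hr_last : r (L + 1) = r L) :
    ∑ l ∈ Finset.Icc 2 L,
      amplification s r L l * (12 * s ^ 2 * r l * r (l + 1) ^ 2 * √(2 ^ (l - 1))) ≤
      constSVD s r L := by
  have hs0 : 0 ≤ s := (zero_lt_one.trans hs).le
  have hle : ∀ l, 2 ≤ l → l ≤ L → r (l + 1) ≤ r l := fun l h1 h2 => by
    rcases h2.lt_or_eq with h | h
    · exact hr_anti l h1 h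
    · rw [h, hr_last]
  set F : ℕ → ℝ := fun l => (2 : ℝ) ^ ((L : ℝ) + (l : ℝ) / 2 + 2) * s ^ (2 * (L - l) + 2) *
      (∏ t ∈ Finset.Icc (l + 1) L, (r t : ℝ)) ^ 2 *
      (r (l + 1) : ℝ) ^ (3 / 2 : ℝ) * (r l : ℝ) ^ (5 / 2 : ℝ) with hF
  have hF0 : ∀ l, 0 ≤ F l := fun l => by positivity
  have hFn : ∀ l, 2 ≤ l → l ≤ L → 4 * nearTerm s r L l ≤ F l := fun l h1 h2 =>
    nearTerm_le hs0 (hr_pos l h1 h2) (hle l h1 h2)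
  have hown : ∀ l, 2 ≤ l → l ≤ L →
      amplification s r L l * (12 * s ^ 2 * r l * r (l + 1) ^ 2 * √(2 ^ (l - 1))) ≤
        5 / 8 * F l := by
    intro l h1 h2
    have hpow : (2 : ℝ) ^ (L - l) ≤ 2 ^ L / 4 := by
      rw [le_div_iff₀ (by norm_num), show (4 : ℝ) = 2 ^ 2 by norm_num, ← pow_add]
      exact pow_le_pow_right₀ (by norm_num) (by omega)
    have hsqrt : √((2 : ℝ) ^ (l - 1)) ≤ 5 / 7 * √(2 ^ l) := by
      have : (2 : ℝ) ^ l = 2 ^ (l - 1) * 2 := by rw [← pow_succ]; congr 1; omega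
      rw [this, Real.sqrt_mul (by positivity)]
      have h7 : (7 / 5 : ℝ) ≤ √2 := Real.le_sqrt_of_sq_le (by norm_num)
      have := Real.sqrt_nonneg ((2 : ℝ) ^ (l - 1))
      nlinarith
    have hn : 0 ≤ nearTerm s r L l := by unfold nearTerm; positivity
    calc _ ≤ (2 ^ L / 4 * s ^ (2 * (L - l)) * (∏ t ∈ Finset.Icc (l + 1) L, (r t : ℝ)) ^ 2) *
          (12 * s ^ 2 * r l * r (l + 1) ^ 2 * (5 / 7 * √(2 ^ l))) := by
          gcongr
          exact (amplification_le hs0 hr_anti hr_last h1).trans (by gcongr)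
      _ = 15 / 7 * nearTerm s r L l := by rw [nearTerm, pow_add s]; ring
      _ ≤ 5 / 8 * F l := by linarith [hFn l h1 h2]
  change _ ≤ ∑ l ∈ Finset.Icc 2 (max 2 (L - 1)), F l
  rcases hL.eq_or_lt with rfl | hL3
  · rw [show max 2 (2 - 1) = 2 from rfl, Finset.Icc_self, Finset.sum_singleton,
      Finset.sum_singleton]
    exact (hown 2 le_rfl le_rfl).trans (by linarith [hF0 2])
  · obtain ⟨M, rfl⟩ : ∃ M, L = M + 1 := ⟨L - 1, by omega⟩
    have hM : 2 ≤ M := by omega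
    have hlast : amplification s r (M + 1) (M + 1) *
        (12 * s ^ 2 * r (M + 1) * r (M + 1 + 1) ^ 2 * √(2 ^ (M + 1 - 1))) ≤ 3 / 8 * F M := by
      refine le_trans ?_ (mul_le_mul_of_nonneg_left (hFn M hM (by omega)) (by norm_num))
      rw [amplification_last, hr_last, nearTerm, Finset.Icc_self, Finset.prod_singleton,
        Nat.add_sub_cancel, Nat.add_sub_cancel_left]
      have h8 : (8 : ℝ) ≤ 2 ^ (M + 1) := by
        rw [show (8 : ℝ) = 2 ^ 3 by norm_num]
        exact pow_le_pow_right₀ (by norm_num) (by omega)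
      have hs4 : s ^ 2 ≤ s ^ (2 * 1 + 2) := pow_le_pow_right₀ hs.le (by norm_num)
      have hr1 : (1 : ℝ) ≤ r (M + 1) := by
        exact_mod_cast hr_pos (M + 1) (by omega) le_rfl
      have hr2 : (1 : ℝ) ≤ r M := by exact_mod_cast hr_pos M hM (by omega)
      have hr3 : (r (M + 1) : ℝ) ≤ r (M + 1) ^ 2 := le_self_pow₀ hr1 two_ne_zero
      calc 1 * (12 * s ^ 2 * (r (M + 1) : ℝ) * r (M + 1) ^ 2 * √(2 ^ M))
          = 3 / 8 * (4 * (8 * √(2 ^ M) * s ^ 2 * r (M + 1) * r (M + 1) ^ 2 * 1)) := by ring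
        _ ≤ _ := by gcongr
    rw [Finset.sum_Icc_succ_top (by omega), show M + 1 - 1 = M from rfl, max_eq_right hM]
    have h1 : ∑ l ∈ Finset.Icc 2 M, amplification s r (M + 1) l *
        (12 * s ^ 2 * r l * r (l + 1) ^ 2 * √(2 ^ (l - 1))) ≤
        5 / 8 * ∑ l ∈ Finset.Icc 2 M, F l := by
      rw [Finset.mul_sum]
      refine Finset.sum_le_sum fun l hl => ?_
      rw [Finset.mem_Icc] at hl
      exact hown l hl.1 (by omega)
    have h2 : F M ≤ ∑ l ∈ Finset.Icc 2 M, F l :=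
      Finset.single_le_sum (fun l _ => hF0 l) (Finset.mem_Icc.2 ⟨hM, le_rfl⟩)
    exact (add_le_add h1 hlast).trans (by linarith)

/-- The squared interpolation constant, with `2 * b` points per node, of which at most `a` are
selected. -/
theorem near_coefficient_le {a b : ℝ} (hs : 1 < s) (ha : 1 ≤ a) (hb : 1 ≤ b) :
    (1 + s * √(2 * b * a)) ^ 2 * (2 * b) ≤ 12 * s ^ 2 * a * b ^ 2 := by
  set c := s * √(2 * b * a) with hc
  have hc2 : c ^ 2 = 2 * (s ^ 2 * (a * b)) := by
    rw [hc, mul_pow, Real.sq_sqrt (by positivity)]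
    ring
  have hge : 1 ≤ s ^ 2 * (a * b) :=
    one_le_mul_of_one_le_of_one_le (one_le_pow₀ hs.le) (one_le_mul_of_one_le_of_one_le ha hb)
  have hc0 : 0 ≤ c := by positivity
  -- `c ≥ √2 ≥ 7 / 5` gives `(1 + c) ^ 2 ≤ 3 * c ^ 2`.
  have hc7 : 7 / 5 ≤ c := by nlinarith
  have h3 : (1 + c) ^ 2 ≤ 3 * c ^ 2 := by nlinarith
  calc (1 + c) ^ 2 * (2 * b) ≤ 3 * c ^ 2 * (2 * b) := by gcongr
    _ = _ := by rw [hc2]; ring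

end Constants

theorem card_bar_le {d n L : ℕ} {T : Partition d L} {x : Fin n → EuclideanSpace ℝ (Fin d)}
    {hat : (k : ℕ) → Node k → Finset (Fin n)} {r : ℕ → ℕ} (hr_last : r (L + 1) = r L)
    (hhat : ∀ k, 0 < k → k < L → ∀ i, (hat k i).card ≤ r (k + 1))
    (hleaf : ∀ i : Node (L - 1), (indicesIn x (T.dom (L - 1) i)).card ≤ 2 * r L)
    {k : ℕ} (hk : k < L) (i : Node k) :
    ((bar T x hat k i).card : ℝ) ≤ 2 * r (k + 2) := by
  norm_cast
  by_cases h : k + 1 < L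
  · rw [bar_of_lt h]
    refine (Finset.card_union_le _ _).trans ?_
    rw [two_mul]
    exact add_le_add (hhat (k + 1) k.succ_pos h _) (hhat (k + 1) k.succ_pos h _)
  · obtain rfl : L = k + 1 := by omega
    rw [bar_leaf h]
    simpa [hr_last] using hleaf i

theorem Run.frobNorm_sub_hss_le {𝕜 : Type*} [RCLike 𝕜] {d n L : ℕ} (hL : 2 ≤ L)
    {T : Partition d L} {A : Matrix (Fin n) (Fin n) 𝕜}
    {x y : Fin n → EuclideanSpace ℝ (Fin d)}
    (hx : ∀ a, x a ∈ T.dom 0 ()) (hy : ∀ b, y b ∈ T.dom 0 ())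
    {τ s εsvd εfar : ℝ} (hs : 1 < s) (hsvd : 0 ≤ εsvd) (hfar : 0 ≤ εfar)
    (R : Run T A x y τ s εsvd εfar) {r : ℕ → ℕ}
    (hr_pos : ∀ l, 2 ≤ l → l ≤ L → 0 < r l)
    (hr_anti : ∀ l, 2 ≤ l → l < L → r (l + 1) ≤ r l)
    (hr_last : r (L + 1) = r L)
    (hrow : ∀ k, 0 < k → k < L → ∀ i, (R.rowHat k i).card ≤ r (k + 1))
    (hcol : ∀ k, 0 < k → k < L → ∀ i, (R.colHat k i).card ≤ r (k + 1))
    (hleaf_row : ∀ i : Node (L - 1), (indicesIn x (T.dom (L - 1) i)).card ≤ 2 * r L)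
    (hleaf_col : ∀ i : Node (L - 1), (indicesIn y (T.dom (L - 1) i)).card ≤ 2 * r L) :
    frobNorm (A - R.hss) ≤
      constSVD s r L * εsvd * frobNorm A + constFar s r L * εfar * frobNorm A := by
  have hs0 : 0 ≤ s := (zero_lt_one.trans hs).le
  have hE : R.telescopeError (L - 1) = A - R.hss := by
    rw [Run.telescopeError, R.extend_levelB_add_offDiag_leaf (by omega) hx hy, R.hss_eq_extend]
  rw [← hE]
  set a : ℕ → ℝ := fun l => 12 * s ^ 2 * r l * r (l + 1) ^ 2 * √(2 ^ (l - 1)) with ha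
  set b : ℕ → ℝ := fun l => 4 * s ^ 2 * r l ^ 2 * r (l + 1) with hb
  have hA0 := frobNorm_nonneg A
  have hrec : ∀ k, k + 1 < L → frobNorm (R.telescopeError (k + 1)) ≤
      s ^ 2 * (2 * r (k + 3) * r (k + 2)) * frobNorm (R.telescopeError k) +
        (a (k + 2) * εsvd * frobNorm A + b (k + 2) * εfar * frobNorm A) := by
    intro k hk
    have hrbar := card_bar_le hr_last hrow hleaf_row hk
    have hcbar := card_bar_le hr_last hcol hleaf_col hk
    have hrhat : ∀ i, ((R.rowHat (k + 1) i).card : ℝ) ≤ r (k + 2) := fun i => by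
      exact_mod_cast hrow (k + 1) k.succ_pos hk i
    have hchat : ∀ i, ((R.colHat (k + 1) i).card : ℝ) ≤ r (k + 2) := fun i => by
      exact_mod_cast hcol (k + 1) k.succ_pos hk i
    have hq : (1 : ℝ) ≤ r (k + 2) := by exact_mod_cast hr_pos (k + 2) (by omega) (by omega)
    have hq' : (1 : ℝ) ≤ r (k + 3) := by
      by_cases h : k + 2 < L
      · exact_mod_cast hr_pos (k + 3) (by omega) h
      · rwa [show k + 3 = L + 1 by omega, hr_last, show L = k + 2 by omega]
    rw [R.telescopeError_succ hk]
    refine (frobNorm_add_le _ _).trans (add_le_add ?_ ?_)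
    · exact R.frobNorm_levelU_mul_levelV_le hs k.succ_pos hk (by positivity) (by positivity)
        hrbar hcbar hrhat hchat _
    · refine (R.frobNorm_levelError_le hs hsvd hfar k.succ_pos hk (by positivity) hq
        hrbar hcbar hrhat hchat).trans (add_le_add ?_ (le_of_eq ?_))
      · have := near_coefficient_le hs hq hq'
        simp only [ha, show k + 2 - 1 = k + 1 from rfl]
        gcongr
      · simp only [hb]
        ring
  have hsum := amplified_le_sum (r := r) (L := L)
    (e := fun k => frobNorm (R.telescopeError k))
    (δ := fun l => a l * εsvd * frobNorm A + b l * εfar * frobNorm A) hs0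
    (by simp only [R.telescopeError_zero, frobNorm_zero]) hrec (L - 1) (by omega)
  rw [show L - 1 + 1 = L by omega, amplification_last, one_mul] at hsum
  refine hsum.trans ?_
  have hsplit : ∑ l ∈ Finset.Icc 2 L, amplification s r L l *
      (a l * εsvd * frobNorm A + b l * εfar * frobNorm A) =
      (∑ l ∈ Finset.Icc 2 L, amplification s r L l * a l) * εsvd * frobNorm A +
      (∑ l ∈ Finset.Icc 2 L, amplification s r L l * b l) * εfar * frobNorm A := by
    simp only [Finset.sum_mul, ← Finset.sum_add_distrib]
    exact Finset.sum_congr rfl fun l _ => by ring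
  rw [hsplit]
  gcongr
  · exact sum_near_le hL hs hr_pos hr_anti hr_last
  · exact sum_far_le hs0 hr_anti hr_last

end SMASH

theorem theorem4p5 {𝕜 : Type*} [RCLike 𝕜] {d n L : ℕ} (hL : 2 ≤ L)
    (T : SMASH.Partition d L)
    (κ : EuclideanSpace ℝ (Fin d) → EuclideanSpace ℝ (Fin d) → 𝕜)
    (x y : Fin n → EuclideanSpace ℝ (Fin d))
    (hx : ∀ a, x a ∈ T.dom 0 ()) (hy : ∀ b, y b ∈ T.dom 0 ())
    (τ s εsvd εfar : ℝ) (hτ : 0 < τ ∧ τ < 1) (hs : 1 < s) (hsvd : 0 ≤ εsvd) (hfar : 0 ≤ εfar)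
    (R : SMASH.Run T (SMASH.kernelMatrix κ x y) x y τ s εsvd εfar)
    (r : ℕ → ℕ)
    (hr_pos : ∀ l, 2 ≤ l → l ≤ L → 0 < r l)
    (hr_anti : ∀ l, 2 ≤ l → l < L → r (l + 1) ≤ r l)
    (hr_last : r (L + 1) = r L)
    (hrow : ∀ k, 0 < k → k < L → ∀ i, (R.rowHat k i).card ≤ r (k + 1))
    (hcol : ∀ k, 0 < k → k < L → ∀ i, (R.colHat k i).card ≤ r (k + 1))
    (hleaf_row : ∀ i : SMASH.Node (L - 1),
      (SMASH.indicesIn x (T.dom (L - 1) i)).card ≤ 2 * r L)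
    (hleaf_col : ∀ i : SMASH.Node (L - 1),
      (SMASH.indicesIn y (T.dom (L - 1) i)).card ≤ 2 * r L) :
    ∃ E : Matrix (Fin n) (Fin n) 𝕜,
      SMASH.kernelMatrix κ x y = R.hss + E ∧
      SMASH.frobNorm E ≤
        SMASH.constSVD s r L * εsvd * SMASH.frobNorm (SMASH.kernelMatrix κ x y) +
        SMASH.constFar s r L * εfar * SMASH.frobNorm (SMASH.kernelMatrix κ x y) := by
  exact ⟨_ - R.hss, (add_sub_cancel _ _).symm, R.frobNorm_sub_hss_le hL hx hy hs hsvd hfar hr_pos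
    hr_anti hr_last hrow hcol hleaf_row hleaf_col⟩
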